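/- Let $r>0$, $a=r\pi^{1/3}$, $\mathbb B^3=\{x^2+y^2+z^2\le r^2\}$ and $\mathbb K=\{|x|+|y|+|z|\le a\}\subset\mathbb R^3$. Let $\mathcal U$ be given on the first octant, in spherical coordinates $\rho,\theta,\varphi$ (distance to the origin, longitude, colatitude), by $$X=\tfrac{\sqrt2}{\pi^{2/3}}\rho(\pi-2\theta)\sin\tfrac\varphi2,\quad Y=\tfrac{\sqrt2}{\pi^{2/3}}\rho\cdot 2\theta\sin\tfrac\varphi2,\quad Z=\pi^{1/3}\rho\,\bigl(1-\sqrt2\sin\tfrac\varphi2\bigr),$$ and on the other octants by symmetry: $\mathcal U(x,y,z)=(\operatorname{sgn}(x)\overline X,\operatorname{sgn}(y)\overline Y,\operatorname{sgn}(z)\overline Z)$ with $(\overline X,\overline Y,\overline Z)=\mathcal U(|x|,|y|,|z|)$. Let $\mathcal U^{-1}$ be given for $X,Y,Z\ge0$ by $$x=\pi^{-1/3}(X+Y)\,w\cos\tfrac{\pi Y}{2(X+Y)},\quad y=\pi^{-1/3}(X+Y)\,w\sin\tfrac{\pi Y}{2(X+Y)},\quad z=\pi^{-1/3}\tfrac{Z(2X+2Y+Z)}{X+Y+Z},\qquad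 w=\sqrt{2-\bigl(\tfrac{X+Y}{X+Y+Z}\bigr)^2}$$ (a quotient with vanishing denominator being read as $0$), and on the other octants by the same symmetry. **Grid.** Cells are closed tetrahedra $[p_1,p_2,p_3,p_4]$ of type $\mathbf T$ or $\mathbf M$. The level-$0$ cells are the four tetrahedra of type $\mathbf T$ with vertices $(0,0,a),(0,0,-a),(\pm a,0,0),(0,\pm a,0)$ (in this order). Write $p_{ik}=\frac12(p_i+p_k)$. A cell $[p_1,p_2,p_3,p_4]$ is refined into eight cells: the four corner cells $[p_{i1},p_{i2},p_{i3},p_{i4}]$, $i=1,\dots,4$, of the same type as the cell; and, if it is of type $\mathbf T$, the cells $[p_{13},p_{23},p_{34},p_{12}]$, $[p_{14},p_{24},p_{12},p_{34}]$ of type $\mathbf T$ and $[p_{12},p_{34},p_{13},p_{14}]$, $[p_{12},p_{34},p_{23},p_{24}]$ of type $\mathbf M$; if it is of type $\mathbf M$, the cells $[p_{12},p_{34},p_{13},p_{14}]$, $[p_{12},p_{34},p_{14},p_{24}]$, $[p_{12},p_{34},p_{24},p_{23}]$, $[p_{12},p_{34},p_{23},p_{13}]$ of type $\mathbf T$. Refining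 $j$ times gives the cells $D^j_k$, $1\le k\le 4\cdot8^j$, of level $j$; those obtained from a cell $A^j$ of level $j$ are denoted $A^{j+1}_1,\dots,A^{j+1}_8$. **Functions and spaces.** All $L^2$ spaces are with respect to Lebesgue measure, with values in $\mathbb R$ or in $\mathbb C$, and $\operatorname{span}$ is taken over the same field. Put $$\varphi_{D^j_k}=(2\sqrt2)^j\tfrac{2}{\sqrt{\operatorname{vol}(\mathbb K)}}\chi_{D^j_k},\qquad \widetilde{\varphi_{D^j_k}}=\varphi_{D^j_k}\circ\mathcal U,\qquad V^j=\operatorname{span}\{\varphi_{D^j_k}\}_k\subseteq L^2(\mathbb K),\qquad \widetilde{V^j}=\operatorname{span}\{\widetilde{\varphi_{D^j_k}}\}_k\subseteq L^2(\mathbb B^3),$$ and let $W^j$, $\widetilde{W^j}$ be the orthogonal complements of $V^j$ in $V^{j+1}$ and of $\widetilde{V^j}$ in $\widetilde{V^{j+1}}$. For every cell $A^j$ of every level $j\ge0$ choose a real orthogonal $8\times8$ matrix all of whose first-row entries equal $1/(2\sqrt2)$ (for instance one matrix for all cells); let $a_{\ell1},\dots,a_{\ell8}$, $\ell=1,\dots,7$,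 be its other rows, and put $\psi^\ell_{A^j}=\sum_{m=1}^8a_{\ell m}\varphi_{A^{j+1}_m}$ and $\widetilde{\psi^\ell_{A^j}}=\psi^\ell_{A^j}\circ\mathcal U$. **Claim.** 1. $\mathcal U$ maps $\mathbb B^3$ bijectively onto $\mathbb K$, with inverse $\mathcal U^{-1}$. 2. $\Pi\widetilde f=\widetilde f\circ\mathcal U^{-1}$ is a well-defined unitary map of $L^2(\mathbb B^3)$ onto $L^2(\mathbb K)$, with inverse $\Pi^{-1}f=f\circ\mathcal U$; that is, $\langle\Pi\widetilde f,\Pi\widetilde g\rangle_{L^2(\mathbb K)}=\langle\widetilde f,\widetilde g\rangle_{L^2(\mathbb B^3)}$ for all $\widetilde f,\widetilde g\in L^2(\mathbb B^3)$ and $\langle\Pi^{-1}f,\Pi^{-1}g\rangle_{L^2(\mathbb B^3)}=\langle f,g\rangle_{L^2(\mathbb K)}$ for all $f,g\in L^2(\mathbb K)$. Moreover $\widetilde{V^j}=\Pi^{-1}(V^j)$ and $\widetilde{W^j}=\Pi^{-1}(W^j)$ for all $j\ge0$. 3. The spaces $\widetilde{V^j}$ form a multiresolution analysis of $L^2(\mathbb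 B^3)$: $\widetilde{V^j}\subseteq\widetilde{V^{j+1}}$ for all $j\ge0$, the union $\bigcup_{j\ge0}\widetilde{V^j}$ is dense in $L^2(\mathbb B^3)$, and for every $j\ge0$ the family $\{\widetilde{\varphi_{D^j_k}}\}_{1\le k\le 4\cdot8^j}$ is an orthonormal basis of $\widetilde{V^j}$. 4. For every $j\ge0$ the family $\{\widetilde{\psi^\ell_{A^j}}\}$, indexed by $\ell=1,\dots,7$ and the cells $A^j$ of level $j$, is an orthonormal basis of $\widetilde{W^j}$. -/

import Mathlib

noncomputable section

namespace BallWavelets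

open MeasureTheory

/-- Euclidean space `ℝ³`; coordinates `0, 1, 2` are `x, y, z`. -/
abbrev E3 : Type := EuclideanSpace ℝ (Fin 3)

/-! ### The ball, the octahedron and the map between them -/

/-- The closed ball of radius `r` centred at the origin. -/
def ball (r : ℝ) : Set E3 := Metric.closedBall 0 r

/-- Half-diagonal `a = r π^{1/3}` of the octahedron with the same volume as the ball. -/
def halfDiag (r : ℝ) : ℝ := r * Real.pi ^ (1 / 3 : ℝ)

/-- The regular octahedron `|x| + |y| + |z| ≤ a`. -/
def octahedron (r : ℝ) : Set E3 := {p | |p 0| + |p 1| + |p 2| ≤ halfDiag r}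

/-- Distance to the origin. -/
def rho (x y z : ℝ) : ℝ := Real.sqrt (x ^ 2 + y ^ 2 + z ^ 2)

/-- Longitude of a point of the first octant. -/
def theta (x y : ℝ) : ℝ := Complex.arg ⟨x, y⟩

/-- Colatitude of a point of the first octant. -/
def colat (x y z : ℝ) : ℝ := Real.arccos (z / rho x y z)

/-- The map `𝒰`: the spherical-coordinate formulas on the first octant, extended to the other
octants by sign symmetry. -/
def mapU (p : E3) : E3 :=
  let ρ := rho |p 0| |p 1| |p 2|
  let θ := theta |p 0| |p 1|
  let φ := colat |p 0| |p 1| |p 2|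
  !₂[Real.sign (p 0) *
      (Real.sqrt 2 / Real.pi ^ (2 / 3 : ℝ) * ρ * (Real.pi - 2 * θ) * Real.sin (φ / 2)),
    Real.sign (p 1) *
      (Real.sqrt 2 / Real.pi ^ (2 / 3 : ℝ) * ρ * (2 * θ) * Real.sin (φ / 2)),
    Real.sign (p 2) *
      (Real.pi ^ (1 / 3 : ℝ) * ρ * (1 - Real.sqrt 2 * Real.sin (φ / 2)))]

/-- The inverse map `𝒰⁻¹`: explicit formulas on the first octant, extended by sign symmetry.
(The divisions by zero are harmless: they are multiplied by `X + Y = 0` or by `Z = 0`.) -/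
def mapUinv (P : E3) : E3 :=
  let X := |P 0|
  let Y := |P 1|
  let Z := |P 2|
  !₂[Real.sign (P 0) * (Real.pi ^ (-(1 / 3) : ℝ) * (X + Y) *
      Real.sqrt (2 - ((X + Y) / (X + Y + Z)) ^ 2) * Real.cos (Real.pi * Y / (2 * (X + Y)))),
    Real.sign (P 1) * (Real.pi ^ (-(1 / 3) : ℝ) * (X + Y) *
      Real.sqrt (2 - ((X + Y) / (X + Y + Z)) ^ 2) * Real.sin (Real.pi * Y / (2 * (X + Y)))),
    Real.sign (P 2) * (Real.pi ^ (-(1 / 3) : ℝ) * (Z * (2 * X + 2 * Y + Z) / (X + Y + Z)))]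

/-! ### The hierarchical grid of the octahedron -/

/-- The two shapes of cells: `T` (a quarter of a regular octahedron, cut along a vertical
diagonal) and `M` (a regular tetrahedron). -/
inductive CellType
  | T
  | M

/-- A tetrahedral cell: its type and its four vertices. For a cell of type `T`, vertices `0, 1`
are the end points of the vertical edge. For a cell of type `M`, the vertices `0, 1` have the same
altitude, and so do the vertices `2, 3`. -/
structure Cell where
  type : CellType
  vert : Fin 4 → E3

/-- The closed tetrahedron occupied by a cell. -/
def Cell.carrier (c : Cell) : Set E3 := convexHull ℝ (Set.range c.vert)

/-- `c.mid i k` is the mid-point of the vertices `i` and `k` (the vertex `i` itself if `k = i`). -/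
def Cell.mid (c : Cell) (i k : Fin 4) : E3 := (1 / 2 : ℝ) • (c.vert i + c.vert k)

/-- The corner tetrahedron at the vertex `i`, homothetic to the cell with ratio `1/2`. -/
def Cell.corner (c : Cell) (i : Fin 4) : Cell := ⟨c.type, c.mid i⟩

/-- The eight cells into which a cell is refined. In both cases they are the four corner cells
and the four tetrahedra into which the remaining middle octahedron is cut along its diagonal from
`mid 0 1` to `mid 2 3`. For a cell of type `T` this gives two cells of type `T` and two of type
`M`; for a cell of type `M` the diagonal is vertical and this gives four cells of type `T`. -/
def Cell.child (c : Cell) : Fin 8 → Cell :=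
  match c.type with
  | .T => ![c.corner 0, c.corner 1, c.corner 2, c.corner 3,
      ⟨.T, ![c.mid 0 2, c.mid 1 2, c.mid 2 3, c.mid 0 1]⟩,
      ⟨.T, ![c.mid 0 3, c.mid 1 3, c.mid 0 1, c.mid 2 3]⟩,
      ⟨.M, ![c.mid 0 1, c.mid 2 3, c.mid 0 2, c.mid 0 3]⟩,
      ⟨.M, ![c.mid 0 1, c.mid 2 3, c.mid 1 2, c.mid 1 3]⟩]
  | .M => ![
      ⟨.T, ![c.mid 0 1, c.mid 2 3, c.mid 0 2, c.mid 0 3]⟩,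
      ⟨.T, ![c.mid 0 1, c.mid 2 3, c.mid 0 3, c.mid 1 3]⟩,
      ⟨.T, ![c.mid 0 1, c.mid 2 3, c.mid 1 3, c.mid 1 2]⟩,
      ⟨.T, ![c.mid 0 1, c.mid 2 3, c.mid 1 2, c.mid 0 2]⟩,
      c.corner 0, c.corner 1, c.corner 2, c.corner 3]

/-- Sign of `x` on the `i`-th vertical quarter of space. -/
def signX : Fin 4 → ℝ := ![1, -1, -1, 1]

/-- Sign of `y` on the `i`-th vertical quarter of space. -/
def signY : Fin 4 → ℝ := ![1, 1, -1, -1]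

/-- The four cells of level `0`, with vertices `(0,0,a), (0,0,-a), (±a,0,0), (0,±a,0)`. -/
def rootCell (r : ℝ) (i : Fin 4) : Cell :=
  ⟨.T, ![!₂[0, 0, halfDiag r], !₂[0, 0, -halfDiag r],
    !₂[signX i * halfDiag r, 0, 0], !₂[0, signY i * halfDiag r, 0]]⟩

/-- The index set of the `4 · 8^j` cells of level `j`. -/
def Idx : ℕ → Type
  | 0 => Fin 4
  | j + 1 => Idx j × Fin 8

/-- The grid: the cell of level `j` with index `k`; the children of the cell `k` of level `j` are
the cells `(k, m)` of level `j + 1`, `m = 0, …, 7`. -/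
def cell (r : ℝ) : (j : ℕ) → Idx j → Cell
  | 0, i => rootCell r i
  | j + 1, k => (cell r j k.1).child k.2

/-! ### Scaling functions, wavelets and the spaces they span -/

/-- `L²(S)` with values in `𝕜`, with respect to Lebesgue measure. -/
abbrev L2 (𝕜 : Type*) [RCLike 𝕜] (S : Set E3) : Type _ := Lp 𝕜 2 (volume.restrict S)

/-- The scaling function `(2√2)^j · 2 / √vol(K) · χ_D` of the cell `D` of level `j` and index `k`. -/
def scaling (𝕜 : Type*) [RCLike 𝕜] (r : ℝ) (j : ℕ) (k : Idx j) : E3 → 𝕜 :=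
  (cell r j k).carrier.indicator fun _ =>
    (((2 * Real.sqrt 2) ^ j * (2 / Real.sqrt (volume.real (octahedron r))) : ℝ) : 𝕜)

/-- Seven coefficient vectors per cell are taken from the rows `1, …, 7` of a matrix whose row `0`
is the constant one (rows are numbered from `0`): `ψ^ℓ = ∑ₘ a_{ℓ m} φ_{A_m}`. -/
def wavelet (𝕜 : Type*) [RCLike 𝕜] (r : ℝ)
    (a : ∀ j, Idx j → Matrix (Fin 8) (Fin 8) ℝ) (j : ℕ) (k : Idx j) (l : Fin 7) : E3 → 𝕜 :=
  fun p => ∑ m : Fin 8, (a j k l.succ m : 𝕜) * scaling 𝕜 r (j + 1) (k, m) p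

/-- `b` is an orthonormal basis of the (finite-dimensional) space `W`. -/
def IsOrthonormalBasisOf {𝕜 H ι : Type*} [RCLike 𝕜] [NormedAddCommGroup H]
    [InnerProductSpace 𝕜 H] (b : ι → H) (W : Submodule 𝕜 H) : Prop :=
  Orthonormal 𝕜 b ∧ Submodule.span 𝕜 (Set.range b) = W

/-- A multiresolution analysis of `H`: nested subspaces with dense union, together with an
orthonormal basis of each of them. -/
structure IsMultiresolutionAnalysis {𝕜 H : Type*} [RCLike 𝕜] [NormedAddCommGroup H]
    [InnerProductSpace 𝕜 H] (V : ℕ → Submodule 𝕜 H) {ι : ℕ → Type} (b : ∀ j, ι j → H) :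
    Prop where
  nested : ∀ j, V j ≤ V (j + 1)
  dense : closure (⋃ j, (V j : Set H)) = Set.univ
  basis : ∀ j, IsOrthonormalBasisOf (b j) (V j)

/-- The wavelet space of level `j`: the orthogonal complement of `V j` in `V (j + 1)`. -/
def waveletSpace {𝕜 H : Type*} [RCLike 𝕜] [NormedAddCommGroup H]
    [InnerProductSpace 𝕜 H] (V : ℕ → Submodule 𝕜 H) (j : ℕ) : Submodule 𝕜 H :=
  (V j)ᗮ ⊓ V (j + 1)

/-! ### Square integrability, needed to pass to classes in `L²` -/

theorem measurable_sign : Measurable Real.sign := by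
  unfold Real.sign
  exact Measurable.ite measurableSet_Iio measurable_const
    (Measurable.ite measurableSet_Ioi measurable_const measurable_const)

theorem measurable_theta : Measurable fun q : ℝ × ℝ => theta q.1 q.2 := by
  have h : Measurable fun q : ℝ × ℝ => (⟨q.1, q.2⟩ : ℂ) :=
    Complex.measurableEquivRealProd.symm.measurable
  exact Complex.measurable_arg.comp h

theorem measurable_coord (i : Fin 3) : Measurable fun p : E3 => p i := by
  fun_prop

theorem measurable_mapU : Measurable mapU := by
  have h0 := measurable_coord 0
  have h1 := measurable_coord 1
  have h2 := measurable_coord 2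
  have hρ : Measurable fun p : E3 => rho |p 0| |p 1| |p 2| := by
    unfold rho; fun_prop
  have hφ : Measurable fun p : E3 => colat |p 0| |p 1| |p 2| := by
    unfold colat
    exact Real.measurable_arccos.comp (h2.abs.div hρ)
  have hθ : Measurable fun p : E3 => theta |p 0| |p 1| :=
    measurable_theta.comp (h0.abs.prodMk h1.abs)
  have s0 := measurable_sign.comp h0
  have s1 := measurable_sign.comp h1
  have s2 := measurable_sign.comp h2
  have hs : Measurable fun p : E3 => Real.sin (colat |p 0| |p 1| |p 2| / 2) :=
    Real.measurable_sin.comp (hφ.div_const 2)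
  refine (MeasurableEquiv.toLp 2 (Fin 3 → ℝ)).measurable.comp (measurable_pi_iff.2 fun i => ?_)
  fin_cases i
  · exact s0.mul (((hρ.const_mul _).mul (measurable_const.sub (hθ.const_mul 2))).mul hs)
  · exact s1.mul (((hρ.const_mul _).mul (hθ.const_mul 2)).mul hs)
  · exact s2.mul ((hρ.const_mul _).mul (measurable_const.sub (hs.const_mul _)))

theorem measurableSet_carrier (c : Cell) : MeasurableSet c.carrier :=
  ((Set.finite_range c.vert).isCompact_convexHull ℝ).measurableSet

instance isFiniteMeasure_ball (r : ℝ) : IsFiniteMeasure (volume.restrict (ball r)) :=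
  isFiniteMeasure_restrict.2 (isCompact_closedBall (0 : E3) r).measure_lt_top.ne

theorem octahedron_subset (r : ℝ) : octahedron r ⊆ Metric.closedBall 0 (halfDiag r) := by
  intro p hp
  have hp' : |p 0| + |p 1| + |p 2| ≤ halfDiag r := hp
  rw [mem_closedBall_zero_iff, EuclideanSpace.norm_eq, Fin.sum_univ_three]
  simp only [Real.norm_eq_abs]
  refine Real.sqrt_le_iff.2 ⟨le_trans (by positivity) hp', ?_⟩
  have h := pow_le_pow_left₀ (by positivity) hp' 2
  nlinarith [mul_nonneg (abs_nonneg (p 0)) (abs_nonneg (p 1)),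
    mul_nonneg (abs_nonneg (p 0)) (abs_nonneg (p 2)),
    mul_nonneg (abs_nonneg (p 1)) (abs_nonneg (p 2))]

instance isFiniteMeasure_octahedron (r : ℝ) : IsFiniteMeasure (volume.restrict (octahedron r)) :=
  isFiniteMeasure_restrict.2 <| ne_of_lt <|
    (measure_mono (octahedron_subset r)).trans_lt
      (isCompact_closedBall (0 : E3) (halfDiag r)).measure_lt_top

section MemLp

variable (𝕜 : Type*) [RCLike 𝕜] (μ : Measure E3) [IsFiniteMeasure μ] (r : ℝ)

theorem memLp_scaling (j : ℕ) (k : Idx j) : MemLp (scaling 𝕜 r j k) 2 μ :=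
  (memLp_const _).indicator (measurableSet_carrier _)

theorem memLp_scaling_comp (j : ℕ) (k : Idx j) : MemLp (scaling 𝕜 r j k ∘ mapU) 2 μ :=
  (memLp_const (μ := μ) (p := 2)
    (((2 * Real.sqrt 2) ^ j * (2 / Real.sqrt (volume.real (octahedron r))) : ℝ) : 𝕜)).indicator
    (measurable_mapU (measurableSet_carrier (cell r j k)))

theorem memLp_wavelet_comp (a : ∀ j, Idx j → Matrix (Fin 8) (Fin 8) ℝ) (j : ℕ) (k : Idx j)
    (l : Fin 7) : MemLp (wavelet 𝕜 r a j k l ∘ mapU) 2 μ :=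
  memLp_finsetSum (f := fun m p => (a j k l.succ m : 𝕜) * scaling 𝕜 r (j + 1) (k, m) (mapU p))
    Finset.univ fun m _ => (memLp_scaling_comp 𝕜 μ r (j + 1) (k, m)).const_mul _

end MemLp

/-- The class of the scaling function in `L²(K)`. -/
def scalingK (𝕜 : Type*) [RCLike 𝕜] (r : ℝ) (j : ℕ) (k : Idx j) : L2 𝕜 (octahedron r) :=
  (memLp_scaling 𝕜 (volume.restrict (octahedron r)) r j k).toLp _

/-- The class in `L²(B)` of the transported scaling function `φ ∘ 𝒰`. -/
def scalingB (𝕜 : Type*) [RCLike 𝕜] (r : ℝ) (j : ℕ) (k : Idx j) : L2 𝕜 (ball r) :=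
  (memLp_scaling_comp 𝕜 (volume.restrict (ball r)) r j k).toLp _

/-- The class in `L²(B)` of the transported wavelet `ψ ∘ 𝒰`. -/
def waveletB (𝕜 : Type*) [RCLike 𝕜] (r : ℝ) (a : ∀ j, Idx j → Matrix (Fin 8) (Fin 8) ℝ)
    (j : ℕ) (k : Idx j) (l : Fin 7) : L2 𝕜 (ball r) :=
  (memLp_wavelet_comp 𝕜 (volume.restrict (ball r)) r a j k l).toLp _

/-- The space `V^j` in `L²(K)`. -/
def spaceK (𝕜 : Type*) [RCLike 𝕜] (r : ℝ) (j : ℕ) : Submodule 𝕜 (L2 𝕜 (octahedron r)) :=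
  Submodule.span 𝕜 (Set.range (scalingK 𝕜 r j))

/-- The transported space in `L²(B)`. -/
def spaceB (𝕜 : Type*) [RCLike 𝕜] (r : ℝ) (j : ℕ) : Submodule 𝕜 (L2 𝕜 (ball r)) :=
  Submodule.span 𝕜 (Set.range (scalingB 𝕜 r j))

end BallWavelets

end

open BallWavelets MeasureTheory

namespace BallWavelets

/-! Write c = π^{1/3} and σ = √2 sin(φ/2) = √(1 - z/ρ). On the first octant the map reads X + Y =
cρσ, Z = cρ(1 - σ), and Y/(X + Y) = 2θ/π where X + Y ≠ 0. Hence X + Y + Z = cρ: spheres about the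
origin go to ℓ¹-spheres, the ball goes to the octahedron, and ρ, σ, θ can be read off the image,
which yields the inverse (`octUinv_octU`, `octU_octUinv`). Both maps preserve the faces of the
octant, so the identities extend to all of space by sign symmetry.

Inside an octant the inverse is a composition of three maps with Jacobians π/(2s), 2/(c²w) and sw/c,
where s = X + Y. Their product is π/c³ = 1 (`exists_hasFDerivAt_octUinv`). The coordinate planes are
null sets, so `mapU` preserves Lebesgue measure and composition with it is unitary (`unitaryU`). It
remains to work in the octahedron.

The eight children of a cell cover it (`Cell.exists_mem_child`) and each has one eighth of its
volume (`Cell.volume_child`). There is no volume left for overlaps, so the cells of a level are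
disjoint up to null sets and their normalised indicators are orthonormal. A bound on the size of the
cells halves at each refinement, so step functions approximate uniformly continuous functions, and
the union of the spaces is dense.

Finally, the scaling function of a cell is 1/(2√2) times the sum of those of its children. This is
the first row of the orthogonal matrix attached to the cell. The matrix turns the scaling functions
of the children into another orthonormal family with the same span, so its other seven rows span the
orthogonal complement (`isOrthonormalBasisOf_blockRows`). -/

/-! ### Reduction to the first octant by sign symmetry. -/

/-- The formulas of `mapU` on the first octant. -/
noncomputable def octU (q : Fin 3 → ℝ) : Fin 3 → ℝ :=
  ![Real.sqrt 2 / Real.pi ^ (2 / 3 : ℝ) * rho (q 0) (q 1) (q 2) *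
      (Real.pi - 2 * theta (q 0) (q 1)) * Real.sin (colat (q 0) (q 1) (q 2) / 2),
    Real.sqrt 2 / Real.pi ^ (2 / 3 : ℝ) * rho (q 0) (q 1) (q 2) *
      (2 * theta (q 0) (q 1)) * Real.sin (colat (q 0) (q 1) (q 2) / 2),
    Real.pi ^ (1 / 3 : ℝ) * rho (q 0) (q 1) (q 2) *
      (1 - Real.sqrt 2 * Real.sin (colat (q 0) (q 1) (q 2) / 2))]

/-- The formulas of `mapUinv` on the first octant. -/
noncomputable def octUinv (q : Fin 3 → ℝ) : Fin 3 → ℝ :=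
  ![Real.pi ^ (-(1 / 3) : ℝ) * (q 0 + q 1) *
      Real.sqrt (2 - ((q 0 + q 1) / (q 0 + q 1 + q 2)) ^ 2) *
        Real.cos (Real.pi * q 1 / (2 * (q 0 + q 1))),
    Real.pi ^ (-(1 / 3) : ℝ) * (q 0 + q 1) *
      Real.sqrt (2 - ((q 0 + q 1) / (q 0 + q 1 + q 2)) ^ 2) *
        Real.sin (Real.pi * q 1 / (2 * (q 0 + q 1))),
    Real.pi ^ (-(1 / 3) : ℝ) * (q 2 * (2 * q 0 + 2 * q 1 + q 2) / (q 0 + q 1 + q 2))]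

/-- Extension of a map of the first octant by sign symmetry. -/
noncomputable def signExt (F : (Fin 3 → ℝ) → Fin 3 → ℝ) (p : E3) : E3 :=
  WithLp.toLp 2 fun i => Real.sign (p i) * F (fun j => |p j|) i

@[simp] theorem signExt_apply (F : (Fin 3 → ℝ) → Fin 3 → ℝ) (p : E3) (i : Fin 3) :
    signExt F p i = Real.sign (p i) * F (fun j => |p j|) i := rfl

theorem mapU_eq_signExt : mapU = signExt octU := by
  funext p
  ext i
  fin_cases i <;> simp [mapU, octU]

theorem mapUinv_eq_signExt : mapUinv = signExt octUinv := by
  funext p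
  ext i
  fin_cases i <;> simp [mapUinv, octUinv]

theorem abs_sign_of_ne_zero {x : ℝ} (hx : x ≠ 0) : |Real.sign x| = 1 := by
  rcases Real.sign_apply_eq_of_ne_zero x hx with h | h <;> simp [h]

theorem sign_mul_abs_self (x : ℝ) : Real.sign x * |x| = x := by
  rcases lt_trichotomy x 0 with h | rfl | h
  · rw [Real.sign_of_neg h, abs_of_neg h]; ring
  · simp
  · rw [Real.sign_of_pos h, abs_of_pos h]; ring

theorem sign_mul_of_pos (x : ℝ) {y : ℝ} (hy : 0 < y) : Real.sign (x * y) = Real.sign x := by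
  rcases lt_trichotomy x 0 with h | rfl | h
  · rw [Real.sign_of_neg h, Real.sign_of_neg (mul_neg_of_neg_of_pos h hy)]
  · simp
  · rw [Real.sign_of_pos h, Real.sign_of_pos (mul_pos h hy)]

theorem sign_sign (x : ℝ) : Real.sign (Real.sign x) = Real.sign x := by
  rcases Real.sign_apply_eq x with h | h | h <;> rw [h]
  · exact Real.sign_of_neg (by norm_num)
  · simp
  · simp

/-- A self-map of the closed first octant that preserves its faces. -/
structure IsOctantMap (F : (Fin 3 → ℝ) → Fin 3 → ℝ) : Prop where
  nonneg : ∀ q, (∀ i, 0 ≤ q i) → ∀ i, 0 ≤ F q i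
  face : ∀ q, (∀ i, 0 ≤ q i) → ∀ i, q i = 0 → F q i = 0

theorem IsOctantMap.abs_signExt {F : (Fin 3 → ℝ) → Fin 3 → ℝ} (hF : IsOctantMap F) (p : E3)
    (i : Fin 3) : |signExt F p i| = F (fun j => |p j|) i := by
  rw [signExt_apply, abs_mul, abs_of_nonneg (hF.nonneg _ (fun j => abs_nonneg (p j)) i)]
  by_cases h : p i = 0
  · rw [h, hF.face _ (fun j => abs_nonneg (p j)) i (by simp [h])]; simp
  · rw [abs_sign_of_ne_zero h, one_mul]

/-- The extension of `F` keeps the sign of every nonzero coordinate: if `F` sent such a coordinate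
to 0, then `G`, which preserves faces, would return 0 instead of the original value. -/
theorem IsOctantMap.signExt_leftInverse {F G : (Fin 3 → ℝ) → Fin 3 → ℝ} (hF : IsOctantMap F)
    (hG : IsOctantMap G) (h : ∀ q, (∀ i, 0 ≤ q i) → G (F q) = q) :
    Function.LeftInverse (signExt G) (signExt F) := by
  intro p
  ext i
  have h1 : (fun j => |signExt F p j|) = F fun j => |p j| := funext (hF.abs_signExt p)
  rw [signExt_apply, h1, h _ fun j => abs_nonneg (p j)]
  by_cases hp : p i = 0
  · simp [hp]
  · have hpos : 0 < F (fun j => |p j|) i := by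
      refine (hF.nonneg _ (fun j => abs_nonneg (p j)) i).lt_of_ne fun h0 => hp ?_
      have h2 := hG.face _ (hF.nonneg _ fun j => abs_nonneg (p j)) i h0.symm
      rw [h _ fun j => abs_nonneg (p j)] at h2
      exact abs_eq_zero.1 h2
    rw [signExt_apply, sign_mul_of_pos _ hpos, sign_sign, sign_mul_abs_self]

/-! ### The two octant formulas are inverse to each other. -/

theorem pi_third_pos : 0 < Real.pi ^ (1 / 3 : ℝ) := by positivity

theorem pi_two_thirds : Real.pi ^ (2 / 3 : ℝ) = (Real.pi ^ (1 / 3 : ℝ)) ^ 2 := by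
  rw [← Real.rpow_natCast, ← Real.rpow_mul Real.pi_pos.le]; norm_num

theorem pi_third_cube : (Real.pi ^ (1 / 3 : ℝ)) ^ 3 = Real.pi := by
  rw [← Real.rpow_natCast, ← Real.rpow_mul Real.pi_pos.le]; norm_num

theorem pi_neg_third : Real.pi ^ (-(1 / 3) : ℝ) = (Real.pi ^ (1 / 3 : ℝ))⁻¹ :=
  Real.rpow_neg Real.pi_pos.le _

theorem theta_nonneg {x y : ℝ} (hy : 0 ≤ y) : 0 ≤ theta x y := Complex.arg_nonneg_iff.2 hy

theorem theta_le {x y : ℝ} (hx : 0 ≤ x) : theta x y ≤ Real.pi / 2 :=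
  (abs_le.1 (Complex.abs_arg_le_pi_div_two_iff.2 hx)).2

theorem sqrt_two_mul_sin_half_arccos {u : ℝ} (h0 : -1 ≤ u) (h1 : u ≤ 1) :
    Real.sqrt 2 * Real.sin (Real.arccos u / 2) = Real.sqrt (1 - u) := by
  rw [Real.sin_half_eq_sqrt (Real.arccos_nonneg u)
    (by linarith [Real.arccos_le_pi u, Real.pi_pos]), Real.cos_arccos h0 h1,
    ← Real.sqrt_mul (by norm_num), mul_div_cancel₀ _ two_ne_zero]

theorem rho_nonneg (x y z : ℝ) : 0 ≤ rho x y z := Real.sqrt_nonneg _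

theorem abs_le_rho (x y z : ℝ) : |z| ≤ rho x y z :=
  Real.abs_le_sqrt (by nlinarith [sq_nonneg x, sq_nonneg y])

theorem div_rho_mem {x y z : ℝ} (hz : 0 ≤ z) : 0 ≤ z / rho x y z ∧ z / rho x y z ≤ 1 :=
  ⟨div_nonneg hz (rho_nonneg _ _ _),
    div_le_one_of_le₀ ((le_abs_self z).trans (abs_le_rho x y z)) (rho_nonneg _ _ _)⟩

/-- The half-angle formula removes the colatitude, leaving σ = √(1 - z/ρ) as the only parameter
besides ρ and θ. All later computations use this form. -/
theorem octU_eq {q : Fin 3 → ℝ} (hz : 0 ≤ q 2) :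
    octU q = ![Real.pi ^ (1 / 3 : ℝ) * rho (q 0) (q 1) (q 2) *
        Real.sqrt (1 - q 2 / rho (q 0) (q 1) (q 2)) * (1 - 2 * theta (q 0) (q 1) / Real.pi),
      Real.pi ^ (1 / 3 : ℝ) * rho (q 0) (q 1) (q 2) *
        Real.sqrt (1 - q 2 / rho (q 0) (q 1) (q 2)) * (2 * theta (q 0) (q 1) / Real.pi),
      Real.pi ^ (1 / 3 : ℝ) * rho (q 0) (q 1) (q 2) *
        (1 - Real.sqrt (1 - q 2 / rho (q 0) (q 1) (q 2)))] := by
  have hu := div_rho_mem (x := q 0) (y := q 1) hz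
  have h := sqrt_two_mul_sin_half_arccos (u := q 2 / rho (q 0) (q 1) (q 2)) (by linarith) hu.2
  have hc := pi_third_pos
  have hc3 := pi_third_cube
  have hpi := Real.pi_pos
  rw [octU, ← h, pi_two_thirds, colat]
  set c := Real.pi ^ (1 / 3 : ℝ)
  -- This is c³ = π. It gives the horizontal and vertical coordinates the common factor c.
  have hk : 1 / c ^ 2 = c / Real.pi := by
    rw [div_eq_div_iff (by positivity) hpi.ne']; linarith
  congr 1
  · rw [show Real.sqrt 2 / c ^ 2 = Real.sqrt 2 * (1 / c ^ 2) by ring, hk]; field_simp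
  congr 1
  · rw [show Real.sqrt 2 / c ^ 2 = Real.sqrt 2 * (1 / c ^ 2) by ring, hk]; field_simp

theorem isOctantMap_octU : IsOctantMap octU := by
  refine ⟨fun q hq i => ?_, fun q hq i hi => ?_⟩
  · have hc := pi_third_pos.le
    have hρ := rho_nonneg (q 0) (q 1) (q 2)
    have hu := div_rho_mem (x := q 0) (y := q 1) (hq 2)
    have ht := theta_nonneg (x := q 0) (hq 1)
    have ht' := theta_le (y := q 1) (hq 0)
    have h1 : 2 * theta (q 0) (q 1) / Real.pi ≤ 1 :=
      div_le_one_of_le₀ (by linarith) Real.pi_pos.le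
    have h2 : Real.sqrt (1 - q 2 / rho (q 0) (q 1) (q 2)) ≤ 1 :=
      Real.sqrt_le_one.2 (by linarith)
    have h3 := Real.pi_pos.le
    rw [octU_eq (hq 2)]
    fin_cases i
    · exact mul_nonneg (by positivity) (by linarith)
    · simp; positivity
    · exact mul_nonneg (by positivity) (by linarith)
  · rw [octU_eq (hq 2)]
    fin_cases i
    · replace hi : q 0 = 0 := hi
      -- On the z-axis `theta 0 0 = 0`, so the factor 1 - 2θ/π is 1. The coordinate vanishes there
      -- because ρ = 0 or σ = 0. Off the axis θ = π/2 and the angular factor vanishes.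
      rcases (hq 1).eq_or_lt with h | h
      · simp only [hi, ← h]
        by_cases hz : q 2 = 0
        · simp [rho, hz]
        · have : rho 0 0 (q 2) = q 2 := by simp [rho, Real.sqrt_sq (hq 2)]
          simp [this, hz]
      · have : theta 0 (q 1) = Real.pi / 2 := by
          exact Complex.arg_eq_pi_div_two_iff.2 ⟨rfl, h⟩
        simp only [hi, this]
        simp [Real.pi_ne_zero, mul_div_cancel₀]
    · replace hi : q 1 = 0 := hi
      have : theta (q 0) 0 = 0 := Complex.arg_ofReal_of_nonneg (hq 0)
      simp [hi, this]
    · replace hi : q 2 = 0 := hi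
      simp [hi]

theorem isOctantMap_octUinv : IsOctantMap octUinv := by
  refine ⟨fun q hq i => ?_, fun q hq i hi => ?_⟩
  · have h0 := hq 0
    have h1 := hq 1
    have h2 := hq 2
    have hpi := Real.pi_pos.le
    have ht0 : 0 ≤ Real.pi * q 1 / (2 * (q 0 + q 1)) := by positivity
    have ht1 : Real.pi * q 1 / (2 * (q 0 + q 1)) ≤ Real.pi / 2 := by
      refine div_le_of_le_mul₀ (by positivity) (by positivity) ?_
      nlinarith
    fin_cases i
    · exact mul_nonneg (by positivity) (Real.cos_nonneg_of_neg_pi_div_two_le_of_le (by linarith) ht1)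
    · exact mul_nonneg (by positivity)
        (Real.sin_nonneg_of_nonneg_of_le_pi ht0 (by linarith))
    · simp [octUinv]; positivity
  · fin_cases i
    · replace hi : q 0 = 0 := hi
      -- The angle is π/2 unless X = Y = 0, where the factor X + Y vanishes instead.
      by_cases h : q 1 = 0
      · simp [octUinv, hi, h]
      · have : Real.pi * q 1 / (2 * q 1) = Real.pi / 2 := by field_simp
        simp [octUinv, hi, this]
    · replace hi : q 1 = 0 := hi
      simp [octUinv, hi]
    · replace hi : q 2 = 0 := hi
      simp [octUinv, hi]

theorem octU_sum {q : Fin 3 → ℝ} (hz : 0 ≤ q 2) :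
    octU q 0 + octU q 1 + octU q 2 = Real.pi ^ (1 / 3 : ℝ) * rho (q 0) (q 1) (q 2) := by
  rw [octU_eq hz]; simp; ring

theorem octUinv_octU (q : Fin 3 → ℝ) (hq : ∀ i, 0 ≤ q i) : octUinv (octU q) = q := by
  have hpi := Real.pi_pos
  have hc := pi_third_pos
  have hz := hq 2
  obtain ⟨hu0, hu1⟩ := div_rho_mem (x := q 0) (y := q 1) hz
  have hn : ‖(⟨q 0, q 1⟩ : ℂ)‖ = Real.sqrt (q 0 ^ 2 + q 1 ^ 2) := by
    rw [Complex.norm_eq_sqrt_sq_add_sq]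
  have hx : Real.sqrt (q 0 ^ 2 + q 1 ^ 2) * Real.cos (theta (q 0) (q 1)) = q 0 := by
    rw [← hn]; exact Complex.norm_mul_cos_arg _
  have hy : Real.sqrt (q 0 ^ 2 + q 1 ^ 2) * Real.sin (theta (q 0) (q 1)) = q 1 := by
    rw [← hn]; exact Complex.norm_mul_sin_arg _
  have hρ2 : rho (q 0) (q 1) (q 2) ^ 2 = q 0 ^ 2 + q 1 ^ 2 + q 2 ^ 2 :=
    Real.sq_sqrt (by positivity)
  have hρ0 := rho_nonneg (q 0) (q 1) (q 2)
  rcases hρ0.eq_or_lt with h | hρ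
  · have h0 : q 0 = 0 := by rw [← h] at hρ2; nlinarith [sq_nonneg (q 0), sq_nonneg (q 1), sq_nonneg (q 2)]
    have h1 : q 1 = 0 := by rw [← h] at hρ2; nlinarith [sq_nonneg (q 0), sq_nonneg (q 1), sq_nonneg (q 2)]
    have h2 : q 2 = 0 := by rw [← h] at hρ2; nlinarith [sq_nonneg (q 0), sq_nonneg (q 1), sq_nonneg (q 2)]
    have : octU q = 0 := by
      funext i
      refine isOctantMap_octU.face q hq i ?_
      fin_cases i <;> assumption
    rw [this]
    funext i
    rw [isOctantMap_octUinv.face 0 (by simp) i rfl]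
    fin_cases i <;> simp [h0, h1, h2]
  rw [octU_eq hz]
  set ρ := rho (q 0) (q 1) (q 2)
  set θ := theta (q 0) (q 1)
  set σ := Real.sqrt (1 - q 2 / ρ) with hσ
  set c := Real.pi ^ (1 / 3 : ℝ)
  have hσ2 : σ ^ 2 = 1 - q 2 / ρ := Real.sq_sqrt (by linarith)
  have hσ0 : 0 ≤ σ := Real.sqrt_nonneg _
  have hz' : q 2 = ρ * (1 - σ ^ 2) := by rw [hσ2]; field_simp; ring
  have hs : c * ρ * σ * (1 - 2 * θ / Real.pi) + c * ρ * σ * (2 * θ / Real.pi) = c * ρ * σ := by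
    ring
  have hsu : c * ρ * σ + c * ρ * (1 - σ) = c * ρ := by ring
  -- Since z = ρ(1 - σ²), the squared distance to the axis is ρ² - z² = ρ²σ²(2 - σ²).
  have hR : c⁻¹ * (c * ρ * σ) * Real.sqrt (2 - (c * ρ * σ / (c * ρ)) ^ 2) =
      Real.sqrt (q 0 ^ 2 + q 1 ^ 2) := by
    rw [show c * ρ * σ / (c * ρ) = σ by field_simp, show c⁻¹ * (c * ρ * σ) = ρ * σ by field_simp,
      eq_comm, Real.sqrt_eq_iff_mul_self_eq (by positivity) (by positivity)]
    have : Real.sqrt (2 - σ ^ 2) * Real.sqrt (2 - σ ^ 2) = 2 - σ ^ 2 :=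
      Real.mul_self_sqrt (by linarith)
    symm
    calc ρ * σ * Real.sqrt (2 - σ ^ 2) * (ρ * σ * Real.sqrt (2 - σ ^ 2))
        = ρ ^ 2 * σ ^ 2 * (Real.sqrt (2 - σ ^ 2) * Real.sqrt (2 - σ ^ 2)) := by ring
      _ = ρ ^ 2 - (ρ * (1 - σ ^ 2)) ^ 2 := by rw [this]; ring
      _ = q 0 ^ 2 + q 1 ^ 2 := by rw [← hz', hρ2]; ring
  -- The angle is recovered only for σ > 0. For σ = 0 the radius in front of `g` is zero, so the
  -- default value of the quotient is harmless.
  have hang : ∀ g : ℝ → ℝ, Real.sqrt (q 0 ^ 2 + q 1 ^ 2) *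
      g (Real.pi * (c * ρ * σ * (2 * θ / Real.pi)) / (2 * (c * ρ * σ))) =
        Real.sqrt (q 0 ^ 2 + q 1 ^ 2) * g θ := by
    intro g
    rcases hσ0.eq_or_lt with h | h
    · rw [← hR, ← h]; simp
    · congr 2; field_simp
  funext i
  simp only [octUinv, pi_neg_third]
  fin_cases i
  · simp only [Matrix.cons_val_zero, Matrix.cons_val_one, Matrix.cons_val, Fin.zero_eta]
    rw [hs, hsu, hR, hang Real.cos, hx]
  · simp only [Matrix.cons_val_zero, Matrix.cons_val_one, Matrix.cons_val, Fin.mk_one]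
    rw [hs, hsu, hR, hang Real.sin, hy]
  · simp only [Matrix.cons_val_zero, Matrix.cons_val_one, Matrix.cons_val, Fin.reduceFinMk]
    rw [hs, hsu]
    rw [show 2 * (c * ρ * σ * (1 - 2 * θ / Real.pi)) + 2 * (c * ρ * σ * (2 * θ / Real.pi)) =
      2 * (c * ρ * σ) by ring, hz']
    field_simp
    ring

theorem octU_octUinv (q : Fin 3 → ℝ) (hq : ∀ i, 0 ≤ q i) : octU (octUinv q) = q := by
  have hpi := Real.pi_pos
  have hc := pi_third_pos
  have h0 := hq 0
  have h1 := hq 1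
  have h2 := hq 2
  -- On the vertical axis no angle is defined. The first two coordinates vanish because faces are
  -- preserved, and the third then follows from `octU_sum`.
  rcases (add_nonneg h0 h1).eq_or_lt with hs | hs
  · have e0 : q 0 = 0 := by linarith
    have e1 : q 1 = 0 := by linarith
    have hG := isOctantMap_octUinv.face q hq
    have hF := isOctantMap_octU.face _ (isOctantMap_octUinv.nonneg q hq)
    funext i
    fin_cases i
    · exact (hF 0 (hG 0 e0)).trans e0.symm
    · exact (hF 1 (hG 1 e1)).trans e1.symm
    · have h3 : octUinv q 2 = (Real.pi ^ (1 / 3 : ℝ))⁻¹ * q 2 := by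
        rw [← pi_neg_third]
        simp [octUinv, e0, e1]
      have h4 := octU_sum (isOctantMap_octUinv.nonneg q hq 2)
      rw [hF 0 (hG 0 e0), hF 1 (hG 1 e1), hG 0 e0, hG 1 e1, h3, rho] at h4
      have h5 : Real.sqrt (0 ^ 2 + 0 ^ 2 + ((Real.pi ^ (1 / 3 : ℝ))⁻¹ * q 2) ^ 2) =
          (Real.pi ^ (1 / 3 : ℝ))⁻¹ * q 2 := by
        rw [show (0 : ℝ) ^ 2 + 0 ^ 2 + ((Real.pi ^ (1 / 3 : ℝ))⁻¹ * q 2) ^ 2 =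
          ((Real.pi ^ (1 / 3 : ℝ))⁻¹ * q 2) ^ 2 by ring, Real.sqrt_sq (by positivity)]
      rw [h5, mul_inv_cancel_left₀ hc.ne'] at h4
      simpa using h4
  have hG2 := isOctantMap_octUinv.nonneg q hq 2
  rw [octU_eq hG2]
  set s := q 0 + q 1 with hsdef
  set u := s + q 2 with hu
  have hupos : 0 < u := by positivity
  set c := Real.pi ^ (1 / 3 : ℝ)
  set t := Real.pi * q 1 / (2 * s) with ht
  have ht0 : 0 ≤ t := by positivity
  have ht1 : t ≤ Real.pi / 2 := by
    refine div_le_of_le_mul₀ (by positivity) (by positivity) ?_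
    nlinarith
  have hsu1 : s / u ≤ 1 := div_le_one_of_le₀ (by linarith) hupos.le
  have hsu0 : 0 < s / u := by positivity
  set w := Real.sqrt (2 - (s / u) ^ 2) with hw
  have hw0 : 0 < w := Real.sqrt_pos.2 (by nlinarith)
  have hw2 : w ^ 2 = 2 - (s / u) ^ 2 := Real.sq_sqrt (by nlinarith)
  have e0 : octUinv q 0 = c⁻¹ * s * w * Real.cos t := by
    rw [← pi_neg_third]; rfl
  have e1 : octUinv q 1 = c⁻¹ * s * w * Real.sin t := by
    rw [← pi_neg_third]; rfl
  -- In terms of ρ = u/c and σ = s/u this is z = ρ(1 - σ²); the values of ρ and σ are confirmed in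
  -- `hρ` and `hσ`.
  have e2 : octUinv q 2 = c⁻¹ * u * (1 - (s / u) ^ 2) := by
    have : q 2 * (2 * q 0 + 2 * q 1 + q 2) = u ^ 2 - s ^ 2 := by rw [hu, hsdef]; ring
    simp only [octUinv, pi_neg_third, Matrix.cons_val]
    rw [this]
    change c⁻¹ * ((u ^ 2 - s ^ 2) / u) = _
    field_simp
  have hθ : theta (octUinv q 0) (octUinv q 1) = t := by
    have : (⟨octUinv q 0, octUinv q 1⟩ : ℂ) =
        ((c⁻¹ * s * w : ℝ) : ℂ) * (Complex.cos t + Complex.sin t * Complex.I) := by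
      rw [e0, e1, ← Complex.ofReal_cos, ← Complex.ofReal_sin]
      apply Complex.ext <;>
        simp only [Complex.re_ofReal_mul, Complex.im_ofReal_mul, Complex.add_re, Complex.add_im,
          Complex.mul_I_re, Complex.mul_I_im, Complex.ofReal_re, Complex.ofReal_im, neg_zero,
          add_zero, zero_add]
    rw [theta, this, Complex.arg_mul_cos_add_sin_mul_I (by positivity) ⟨by linarith, by linarith⟩]
  have hρ : rho (octUinv q 0) (octUinv q 1) (octUinv q 2) = c⁻¹ * u := by
    rw [rho, Real.sqrt_eq_iff_mul_self_eq (by positivity) (by positivity), e0, e1, e2]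
    have h3 := Real.cos_sq_add_sin_sq t
    symm
    calc c⁻¹ * u * (c⁻¹ * u)
        = (c⁻¹ * s) ^ 2 * (2 - (s / u) ^ 2) + (c⁻¹ * u * (1 - (s / u) ^ 2)) ^ 2 := by
          field_simp; ring
      _ = (c⁻¹ * s) ^ 2 * w ^ 2 * (Real.cos t ^ 2 + Real.sin t ^ 2) +
          (c⁻¹ * u * (1 - (s / u) ^ 2)) ^ 2 := by rw [hw2, h3]; ring
      _ = _ := by ring
  have hσ : Real.sqrt (1 - octUinv q 2 / (c⁻¹ * u)) = s / u := by
    rw [e2, mul_div_cancel_left₀ _ (by positivity), sub_sub_cancel, Real.sqrt_sq hsu0.le]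
  rw [hθ, hρ, hσ, ht]
  funext i
  fin_cases i
  · simp; field_simp; rw [hsdef]; ring
  · simp; field_simp
  · simp; field_simp; rw [hu]; ring

theorem mapUinv_mapU : Function.LeftInverse mapUinv mapU := by
  rw [mapU_eq_signExt, mapUinv_eq_signExt]
  exact isOctantMap_octU.signExt_leftInverse isOctantMap_octUinv octUinv_octU

theorem mapU_mapUinv : Function.RightInverse mapUinv mapU := by
  rw [mapU_eq_signExt, mapUinv_eq_signExt]
  exact isOctantMap_octUinv.signExt_leftInverse isOctantMap_octU octU_octUinv

/-- The ℓ¹ norm of `mapU p` is π^{1/3} times the Euclidean norm of `p`. -/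
theorem mapU_mem_octahedron {r : ℝ} {p : E3} : mapU p ∈ octahedron r ↔ p ∈ ball r := by
  have h : |mapU p 0| + |mapU p 1| + |mapU p 2| = Real.pi ^ (1 / 3 : ℝ) * ‖p‖ := by
    rw [mapU_eq_signExt]
    simp only [isOctantMap_octU.abs_signExt]
    rw [octU_sum (abs_nonneg _), EuclideanSpace.norm_eq, Fin.sum_univ_three]
    simp [rho]
  rw [ball, mem_closedBall_zero_iff, octahedron, Set.mem_ofPred_eq, h, halfDiag, mul_comm r,
    mul_le_mul_iff_right₀ pi_third_pos]

theorem mapU_preimage_octahedron (r : ℝ) : mapU ⁻¹' octahedron r = ball r :=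
  Set.ext fun _ => mapU_mem_octahedron

theorem bijOn_mapU (r : ℝ) : Set.BijOn mapU (ball r) (octahedron r) :=
  ⟨fun _ hp => mapU_mem_octahedron.2 hp, mapUinv_mapU.injective.injOn, fun P hP =>
    ⟨mapUinv P, mapU_mem_octahedron.1 ((mapU_mapUinv P).symm ▸ hP), mapU_mapUinv P⟩⟩

/-! ### The Jacobian determinant and preservation of volume. -/

/-- Each row may be differentiated by whatever calculus rules apply and is compared with the
explicit matrix only by its values. The determinant is then that of the matrix. -/
theorem hasFDerivAt_toLin'_of_rows {n : ℕ} {f : (Fin n → ℝ) → Fin n → ℝ}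
    {M : Matrix (Fin n) (Fin n) ℝ} {q : Fin n → ℝ}
    (h : ∀ i, ∃ A : (Fin n → ℝ) →L[ℝ] ℝ, HasFDerivAt (fun p => f p i) A q ∧
      ∀ v, A v = ∑ j, M i j * v j) :
    HasFDerivAt f (LinearMap.toContinuousLinearMap (Matrix.toLin' M)) q := by
  refine hasFDerivAt_pi'.2 fun i => ?_
  obtain ⟨A, hA, hAv⟩ := h i
  have : (ContinuousLinearMap.proj (R := ℝ) (φ := fun _ => ℝ) i).comp
      (LinearMap.toContinuousLinearMap (Matrix.toLin' M)) = A := by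
    ext v
    simp [hAv, Matrix.mulVec, dotProduct]
  exact this ▸ hA

theorem hasFDerivAt_div {E : Type*} [NormedAddCommGroup E] [NormedSpace ℝ E] {f g : E → ℝ}
    {f' g' : E →L[ℝ] ℝ} {x : E} (hf : HasFDerivAt f f' x) (hg : HasFDerivAt g g' x)
    (h : g x ≠ 0) :
    HasFDerivAt (fun p => f p / g p) (f x • (-(g x ^ 2)⁻¹ • g') + (g x)⁻¹ • f') x := by
  simp only [div_eq_mul_inv]
  exact hf.mul ((hasDerivAt_inv h).comp_hasFDerivAt x hg)

theorem det_toContinuousLinearMap_toLin' {n : ℕ} (M : Matrix (Fin n) (Fin n) ℝ) :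
    (LinearMap.toContinuousLinearMap (Matrix.toLin' M)).det = M.det := by
  simp [ContinuousLinearMap.det]

/-- Base sum and base angle of a point of the first octant of the octahedron. -/
noncomputable def toAngle (q : Fin 3 → ℝ) : Fin 3 → ℝ :=
  ![q 0 + q 1, Real.pi * q 1 / (2 * (q 0 + q 1)), q 2]

/-- The passage to cylindrical radius and altitude in the ball. -/
noncomputable def toCyl (q : Fin 3 → ℝ) : Fin 3 → ℝ :=
  ![Real.pi ^ (-(1 / 3) : ℝ) * q 0 * Real.sqrt (2 - (q 0 / (q 0 + q 2)) ^ 2), q 1,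
    Real.pi ^ (-(1 / 3) : ℝ) * (q 2 * (2 * q 0 + q 2) / (q 0 + q 2))]

/-- Cylindrical coordinates. -/
noncomputable def cyl (q : Fin 3 → ℝ) : Fin 3 → ℝ :=
  ![q 0 * Real.cos (q 1), q 0 * Real.sin (q 1), q 2]

theorem octUinv_eq_comp (q : Fin 3 → ℝ) : octUinv q = cyl (toCyl (toAngle q)) := by
  simp [octUinv, cyl, toCyl, toAngle, mul_add]

theorem hasFDerivAt_coord {n : ℕ} (i : Fin n) (q : Fin n → ℝ) :
    HasFDerivAt (fun p : Fin n → ℝ => p i) (ContinuousLinearMap.proj (R := ℝ) (φ := fun _ => ℝ) i)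
      q := hasFDerivAt_apply i q

theorem hasFDerivAt_toAngle {q : Fin 3 → ℝ} (h : q 0 + q 1 ≠ 0) :
    HasFDerivAt toAngle (LinearMap.toContinuousLinearMap (Matrix.toLin'
      !![1, 1, 0; -(Real.pi * q 1) / (2 * (q 0 + q 1) ^ 2),
        Real.pi * q 0 / (2 * (q 0 + q 1) ^ 2), 0; 0, 0, 1])) q := by
  have h0 := hasFDerivAt_coord 0 q
  have h1 := hasFDerivAt_coord 1 q
  refine hasFDerivAt_toLin'_of_rows fun i => ?_
  fin_cases i
  · exact ⟨_, h0.add h1, fun v => by simp [Fin.sum_univ_three]⟩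
  · refine ⟨_, hasFDerivAt_div (h1.const_mul Real.pi) ((h0.add h1).const_mul 2) (by simpa using h), fun v => ?_⟩
    simp [Fin.sum_univ_three]
    field_simp
    ring
  · exact ⟨_, hasFDerivAt_coord 2 q, fun v => by simp [Fin.sum_univ_three]⟩

theorem hasFDerivAt_cyl (q : Fin 3 → ℝ) :
    HasFDerivAt cyl (LinearMap.toContinuousLinearMap (Matrix.toLin'
      !![Real.cos (q 1), -(q 0 * Real.sin (q 1)), 0;
        Real.sin (q 1), q 0 * Real.cos (q 1), 0; 0, 0, 1])) q := by
  have h0 := hasFDerivAt_coord 0 q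
  have h1 := hasFDerivAt_coord 1 q
  refine hasFDerivAt_toLin'_of_rows fun i => ?_
  fin_cases i
  · refine ⟨_, h0.mul h1.cos, fun v => ?_⟩
    simp [Fin.sum_univ_three]; ring
  · refine ⟨_, h0.mul h1.sin, fun v => ?_⟩
    simp [Fin.sum_univ_three]; ring
  · exact ⟨_, hasFDerivAt_coord 2 q, fun v => by simp [Fin.sum_univ_three]⟩

theorem hasFDerivAt_toCyl {q : Fin 3 → ℝ} {w : ℝ} (hu : q 0 + q 2 ≠ 0)
    (hw : 2 - (q 0 / (q 0 + q 2)) ^ 2 ≠ 0) (hw' : Real.sqrt (2 - (q 0 / (q 0 + q 2)) ^ 2) = w)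
    (hw0 : w ≠ 0) :
    HasFDerivAt toCyl (LinearMap.toContinuousLinearMap (Matrix.toLin'
      !![Real.pi ^ (-(1 / 3) : ℝ) * (w - q 0 ^ 2 * q 2 / ((q 0 + q 2) ^ 3 * w)), 0,
        Real.pi ^ (-(1 / 3) : ℝ) * (q 0 ^ 3 / ((q 0 + q 2) ^ 3 * w)); 0, 1, 0;
        Real.pi ^ (-(1 / 3) : ℝ) * (1 - 2 * q 0 / (q 0 + q 2) + q 0 ^ 2 / (q 0 + q 2) ^ 2), 0,
        Real.pi ^ (-(1 / 3) : ℝ) * (1 + q 0 ^ 2 / (q 0 + q 2) ^ 2)])) q := by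
  have h0 := hasFDerivAt_coord 0 q
  have h2 := hasFDerivAt_coord 2 q
  refine hasFDerivAt_toLin'_of_rows fun i => ?_
  fin_cases i
  · refine ⟨_, (h0.const_mul (Real.pi ^ (-(1 / 3) : ℝ))).mul
      ((((hasFDerivAt_div h0 (h0.add h2) hu).pow 2).const_sub 2).sqrt hw), fun v => ?_⟩
    simp [Fin.sum_univ_three]
    rw [hw']
    field_simp
    ring
  · exact ⟨_, hasFDerivAt_coord 1 q, fun v => by simp [Fin.sum_univ_three]⟩
  · refine ⟨_, (hasFDerivAt_div (h2.mul ((h0.const_mul 2).add h2)) (h0.add h2) hu).const_mul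
      (Real.pi ^ (-(1 / 3) : ℝ)), fun v => ?_⟩
    simp [Fin.sum_univ_three]
    field_simp
    ring

/-- The chain rule through `toAngle`, `toCyl` and `cyl` gives the product π/(2s) · 2/(c²w) · sw/c =
π/c³ = 1. The inverse map is the convenient one to differentiate, since its formula contains neither
`arccos` nor `arg`. -/
theorem exists_hasFDerivAt_octUinv {q : Fin 3 → ℝ} (hq : ∀ i, 0 < q i) :
    ∃ A : (Fin 3 → ℝ) →L[ℝ] (Fin 3 → ℝ), HasFDerivAt octUinv A q ∧ A.det = 1 := by
  have h0 := hq 0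
  have h1 := hq 1
  have h2 := hq 2
  set s := q 0 + q 1 with hs
  have hs0 : 0 < s := by positivity
  have hk : s / (s + q 2) < 1 := (div_lt_one (by positivity)).2 (by linarith)
  have hk0 : 0 < s / (s + q 2) := by positivity
  have hw2 : 0 < 2 - (s / (s + q 2)) ^ 2 := by nlinarith
  set w := Real.sqrt (2 - (s / (s + q 2)) ^ 2) with hw
  have hw0 : 0 < w := Real.sqrt_pos.2 hw2
  have hww : w ^ 2 = 2 - (s / (s + q 2)) ^ 2 := Real.sq_sqrt hw2.le
  have d1 := hasFDerivAt_toAngle (q := q) hs0.ne'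
  have e0 : toAngle q 0 = s := rfl
  have e2 : toAngle q 2 = q 2 := rfl
  have d2 := hasFDerivAt_toCyl (q := toAngle q) (w := w) (by rw [e0, e2]; positivity)
    (by rw [e0, e2]; positivity) (by rw [e0, e2]) hw0.ne'
  have d3 := hasFDerivAt_cyl (toCyl (toAngle q))
  have e3 : toCyl (toAngle q) 0 = Real.pi ^ (-(1 / 3) : ℝ) * s * w := rfl
  have hcomp : octUinv = cyl ∘ toCyl ∘ toAngle := funext octUinv_eq_comp
  rw [hcomp]
  refine ⟨_, d3.comp q (d2.comp q d1), ?_⟩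
  simp only [ContinuousLinearMap.det, ContinuousLinearMap.toLinearMap_comp, LinearMap.det_comp,
    LinearMap.coe_toContinuousLinearMap, LinearMap.det_toLin', Matrix.det_fin_three]
  simp only [e0, e2, e3, pi_neg_third]
  have hc := pi_third_pos
  have hc3 := pi_third_cube
  set c := Real.pi ^ (1 / 3 : ℝ)
  have hcs := Real.cos_sq_add_sin_sq (toCyl (toAngle q) 1)
  set C := Real.cos (toCyl (toAngle q) 1)
  set S := Real.sin (toCyl (toAngle q) 1)
  have hpi := Real.pi_pos
  simp only [Matrix.of_apply, Matrix.cons_val', Matrix.cons_val_zero, Matrix.cons_val_one,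
    Matrix.cons_val_fin_one, Matrix.cons_val, mul_zero, zero_mul, sub_zero, add_zero, mul_one,
    one_mul]
  set u := s + q 2 with hu
  have hu0 : 0 < u := by positivity
  have hq2 : q 2 = u - s := by rw [hu]; ring
  have h1' : C * (c⁻¹ * s * w * C) - -(c⁻¹ * s * w * S) * S = c⁻¹ * s * w := by
    linear_combination c⁻¹ * s * w * hcs
  have h3' : Real.pi * q 0 / (2 * (q 0 + q 1) ^ 2) - -(Real.pi * q 1) / (2 * (q 0 + q 1) ^ 2) =
      Real.pi / (2 * s) := by
    rw [← hs]; field_simp; rw [hs]; ring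
  -- The determinant of `toCyl` is c⁻² times the bracket. The factor w, supplied by the Jacobian of
  -- `cyl`, clears the denominators w and leaves w² = 2 - (s/u)².
  have h2' : w * ((w - s ^ 2 * q 2 / (u ^ 3 * w)) * (1 + s ^ 2 / u ^ 2) -
      s ^ 3 / (u ^ 3 * w) * (1 - 2 * s / u + s ^ 2 / u ^ 2)) = 2 := by
    have : w * ((w - s ^ 2 * q 2 / (u ^ 3 * w)) * (1 + s ^ 2 / u ^ 2) -
        s ^ 3 / (u ^ 3 * w) * (1 - 2 * s / u + s ^ 2 / u ^ 2)) =
        (w ^ 2 - s ^ 2 * q 2 / u ^ 3) * (1 + s ^ 2 / u ^ 2) -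
        s ^ 3 / u ^ 3 * (1 - 2 * s / u + s ^ 2 / u ^ 2) := by
      field_simp
    rw [this, hww, hq2]
    field_simp
    ring
  rw [h1', h3']
  calc _ = (c ^ 3)⁻¹ * Real.pi / 2 * (w * ((w - s ^ 2 * q 2 / (u ^ 3 * w)) * (1 + s ^ 2 / u ^ 2) -
      s ^ 3 / (u ^ 3 * w) * (1 - 2 * s / u + s ^ 2 / u ^ 2))) := by
        generalize (w - s ^ 2 * q 2 / (u ^ 3 * w)) = a
        generalize s ^ 3 / (u ^ 3 * w) = b
        generalize (1 - 2 * s / u + s ^ 2 / u ^ 2) = d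
        field_simp
    _ = 1 := by rw [h2', hc3]; field_simp

/-- `mapUinv` in the coordinate space. -/
noncomputable def coordUinv (q : Fin 3 → ℝ) : Fin 3 → ℝ := (mapUinv (WithLp.toLp 2 q)).ofLp

theorem coordUinv_apply (q : Fin 3 → ℝ) (i : Fin 3) :
    coordUinv q i = Real.sign (q i) * octUinv (fun j => |q j|) i := by
  rw [coordUinv, mapUinv_eq_signExt, signExt_apply]

theorem eventually_sign_eq {x : ℝ} (hx : x ≠ 0) : ∀ᶠ y in nhds x, Real.sign y = Real.sign x := by
  rcases hx.lt_or_gt with h | h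
  · filter_upwards [gt_mem_nhds h] with y hy
    rw [Real.sign_of_neg h, Real.sign_of_neg hy]
  · filter_upwards [lt_mem_nhds h] with y hy
    rw [Real.sign_of_pos h, Real.sign_of_pos hy]

theorem abs_eq_sign_mul (x : ℝ) : |x| = Real.sign x * x := by
  rcases lt_trichotomy x 0 with h | rfl | h
  · rw [Real.sign_of_neg h, abs_of_neg h]; ring
  · simp
  · rw [Real.sign_of_pos h, abs_of_pos h]; ring

/-- Off the coordinate planes the signs are locally constant, so the map is locally D ∘ `octUinv` ∘
D for one diagonal reflection D, and (det D)² = 1. -/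
theorem exists_hasFDerivAt_coordUinv {q : Fin 3 → ℝ} (hq : ∀ i, q i ≠ 0) :
    ∃ A : (Fin 3 → ℝ) →L[ℝ] (Fin 3 → ℝ), HasFDerivAt coordUinv A q ∧ A.det = 1 := by
  obtain ⟨A, hA, hdet⟩ := exists_hasFDerivAt_octUinv (q := fun j => |q j|)
    fun i => abs_pos.2 (hq i)
  set D : (Fin 3 → ℝ) →L[ℝ] (Fin 3 → ℝ) := LinearMap.toContinuousLinearMap
    (Matrix.toLin' (Matrix.diagonal fun i => Real.sign (q i))) with hD
  have hDv : ∀ v i, D v i = Real.sign (q i) * v i := fun v i => by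
    simp [hD, Matrix.mulVec_diagonal]
  have hDq : D q = fun j => |q j| := funext fun j => by rw [hDv, abs_eq_sign_mul]
  have hDdet : D.det * D.det = 1 := by
    rw [hD, det_toContinuousLinearMap_toLin', Matrix.det_diagonal, ← Finset.prod_mul_distrib]
    refine Finset.prod_eq_one fun i _ => ?_
    rw [← abs_mul_abs_self, abs_sign_of_ne_zero (hq i), one_mul]
  refine ⟨D.comp (A.comp D), ?_, ?_⟩
  · have h1 : HasFDerivAt (D ∘ octUinv ∘ D) (D.comp (A.comp D)) q :=
      D.hasFDerivAt.comp q (HasFDerivAt.comp q (by rwa [hDq]) D.hasFDerivAt)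
    refine h1.congr_of_eventuallyEq ?_
    have h2 : ∀ᶠ p in nhds q, ∀ i, Real.sign (p i) = Real.sign (q i) :=
      Filter.eventually_all.2 fun i =>
        (continuous_apply i).continuousAt.eventually (eventually_sign_eq (hq i))
    filter_upwards [h2] with p hp
    have h3 : (fun j => |p j|) = D p := funext fun j => by rw [hDv, abs_eq_sign_mul, hp]
    funext i
    rw [coordUinv_apply, h3, hp, Function.comp_apply, Function.comp_apply, hDv]
  · simp only [ContinuousLinearMap.det, ContinuousLinearMap.toLinearMap_comp,
      LinearMap.det_comp] at hdet hDdet ⊢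
    rw [hdet, one_mul, hDdet]

theorem volume_coord_eq_zero (i : Fin 3) : volume {q : Fin 3 → ℝ | q i = 0} = 0 :=
  Measure.pi_hyperplane (fun _ : Fin 3 => (volume : Measure ℝ)) i 0

/-- The change of variables formula applies off the coordinate planes. These are null and are mapped
into themselves, so they contribute nothing on either side. -/
theorem volume_image_coordUinv (hinj : Function.Injective coordUinv) {A : Set (Fin 3 → ℝ)}
    (hA : MeasurableSet A) : volume (coordUinv '' A) = volume A := by
  set N : Set (Fin 3 → ℝ) := {q | ∃ i, q i = 0} with hN
  have hN0 : volume N = 0 := by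
    have : N = ⋃ i, {q : Fin 3 → ℝ | q i = 0} := by ext; simp [hN]
    rw [this]
    exact measure_iUnion_null volume_coord_eq_zero
  have hNm : MeasurableSet N := by
    have : N = ⋃ i, {q : Fin 3 → ℝ | q i = 0} := by ext; simp [hN]
    rw [this]
    exact MeasurableSet.iUnion fun i => measurableSet_eq_fun (measurable_pi_apply i) measurable_const
  have h1 : volume (coordUinv '' (A \ N)) = volume (A \ N) := by
    have hd : ∀ q : Fin 3 → ℝ, ∃ B : (Fin 3 → ℝ) →L[ℝ] (Fin 3 → ℝ),
        q ∉ N → HasFDerivAt coordUinv B q ∧ B.det = 1 := fun q => by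
      by_cases hq : q ∈ N
      · exact ⟨0, fun h => absurd hq h⟩
      · obtain ⟨B, hB⟩ := exists_hasFDerivAt_coordUinv (q := q) fun i hi => hq ⟨i, hi⟩
        exact ⟨B, fun _ => hB⟩
    choose B hB using hd
    rw [← lintegral_abs_det_fderiv_eq_addHaar_image volume (hA.diff hNm)
      (fun q hq => (hB q hq.2).1.hasFDerivWithinAt) hinj.injOn,
      setLIntegral_congr_fun (g := fun _ => 1) (hA.diff hNm)
        (fun q hq => by simp [(hB q hq.2).2]), setLIntegral_one]
  have h2 : volume (coordUinv '' (A ∩ N)) = 0 := by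
    refine measure_mono_null ?_ hN0
    rintro _ ⟨q, ⟨-, i, hi⟩, rfl⟩
    exact ⟨i, by rw [coordUinv_apply, hi]; simp⟩
  refine le_antisymm ?_ ?_
  · calc volume (coordUinv '' A)
        ≤ volume (coordUinv '' (A ∩ N)) + volume (coordUinv '' (A \ N)) := by
          rw [← Set.inter_union_sdiff A N, Set.image_union]
          simpa using measure_union_le _ _
      _ ≤ volume A := by rw [h1, h2, zero_add]; exact measure_mono Set.sdiff_subset
  · rw [← measure_sdiff_null hN0, ← h1]
    exact measure_mono (Set.image_mono Set.sdiff_subset)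

theorem measurePreserving_mapU : MeasurePreserving mapU := by
  set f : (Fin 3 → ℝ) → Fin 3 → ℝ := fun q => (mapU (WithLp.toLp 2 q)).ofLp with hf
  have hm : Measurable f :=
    (PiLp.volume_preserving_ofLp (Fin 3)).measurable.comp
      (measurable_mapU.comp (PiLp.volume_preserving_toLp (Fin 3)).measurable)
  have hl : Function.LeftInverse f coordUinv := fun q => by
    simp only [hf, coordUinv]
    exact congrArg WithLp.ofLp (mapU_mapUinv (WithLp.toLp 2 q))
  have hr : Function.RightInverse f coordUinv := fun q => by
    simp only [hf, coordUinv]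
    exact congrArg WithLp.ofLp (mapUinv_mapU (WithLp.toLp 2 q))
  have hp : MeasurePreserving f := by
    refine ⟨hm, Measure.ext fun A hA => ?_⟩
    rw [Measure.map_apply hm hA, ← Set.image_eq_preimage_of_inverse hl hr,
      volume_image_coordUinv hl.injective hA]
  exact (PiLp.volume_preserving_toLp (Fin 3)).comp (hp.comp (PiLp.volume_preserving_ofLp (Fin 3)))

theorem measurable_mapUinv : Measurable mapUinv := by
  have h0 := measurable_coord 0
  have h1 := measurable_coord 1
  have h2 := measurable_coord 2
  have s0 := measurable_sign.comp h0
  have s1 := measurable_sign.comp h1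
  have s2 := measurable_sign.comp h2
  refine (MeasurableEquiv.toLp 2 (Fin 3 → ℝ)).measurable.comp (measurable_pi_iff.2 fun i => ?_)
  fin_cases i
  · refine s0.mul ?_
    simp only
    fun_prop
  · refine s1.mul ?_
    simp only
    fun_prop
  · refine s2.mul ?_
    simp only
    fun_prop

/-- `mapU` as a measurable equivalence. -/
noncomputable def equivU : E3 ≃ᵐ E3 where
  toFun := mapU
  invFun := mapUinv
  left_inv := mapUinv_mapU
  right_inv := mapU_mapUinv
  measurable_toFun := measurable_mapU
  measurable_invFun := measurable_mapUinv

theorem measurePreserving_mapU_restrict (r : ℝ) :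
    MeasurePreserving mapU (volume.restrict (ball r)) (volume.restrict (octahedron r)) := by
  rw [← mapU_preimage_octahedron]
  exact MeasurePreserving.restrict_preimage_emb measurePreserving_mapU
    equivU.measurableEmbedding _

theorem measurePreserving_mapUinv_restrict (r : ℝ) :
    MeasurePreserving mapUinv (volume.restrict (octahedron r)) (volume.restrict (ball r)) :=
  MeasurePreserving.symm equivU (measurePreserving_mapU_restrict r)

/-! ### Children cover their cell. -/

theorem mem_convexHull_range {ι E : Type*} [Fintype ι] [AddCommGroup E] [Module ℝ E] {v : ι → E}
    {p : E} : p ∈ convexHull ℝ (Set.range v) ↔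
      ∃ l : ι → ℝ, (∀ i, 0 ≤ l i) ∧ ∑ i, l i = 1 ∧ ∑ i, l i • v i = p := by
  constructor
  · intro hp
    have h : convexHull ℝ (Set.range v) ⊆
        {p | ∃ l : ι → ℝ, (∀ i, 0 ≤ l i) ∧ ∑ i, l i = 1 ∧ ∑ i, l i • v i = p} := by
      classical
      refine convexHull_min ?_ ?_
      · rintro _ ⟨i, rfl⟩
        exact ⟨fun j => if j = i then 1 else 0, fun j => by dsimp only; split_ifs <;> norm_num, by simp,
          by simp⟩
      · rintro _ ⟨l, hl, hl1, rfl⟩ _ ⟨m, hm, hm1, rfl⟩ a b ha hb hab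
        refine ⟨fun i => a * l i + b * m i, fun i => ?_, ?_, ?_⟩
        · have := hl i; have := hm i; positivity
        · rw [Finset.sum_add_distrib, ← Finset.mul_sum, ← Finset.mul_sum, hl1, hm1]; simpa using hab
        · simp [add_smul, Finset.sum_add_distrib, Finset.smul_sum, mul_smul]
    exact h hp
  · rintro ⟨l, hl, hl1, rfl⟩
    exact (convex_convexHull ℝ _).sum_mem (fun i _ => hl i) hl1
      fun i _ => subset_convexHull ℝ _ ⟨i, rfl⟩

theorem Cell.mem_carrier {c : Cell} {p : E3} : p ∈ c.carrier ↔
    ∃ l : Fin 4 → ℝ, (∀ i, 0 ≤ l i) ∧ ∑ i, l i = 1 ∧ ∑ i, l i • c.vert i = p :=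
  mem_convexHull_range

theorem Cell.mem_carrier_of_weights {c : Cell} {p : E3} (l0 l1 l2 l3 : ℝ) (h0 : 0 ≤ l0)
    (h1 : 0 ≤ l1) (h2 : 0 ≤ l2) (h3 : 0 ≤ l3) (h : l0 + l1 + l2 + l3 = 1)
    (hp : l0 • c.vert 0 + l1 • c.vert 1 + l2 • c.vert 2 + l3 • c.vert 3 = p) : p ∈ c.carrier := by
  refine Cell.mem_carrier.2 ⟨![l0, l1, l2, l3], fun i => ?_, ?_, ?_⟩
  · fin_cases i <;> simpa
  · simpa [Fin.sum_univ_four] using h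
  · simpa [Fin.sum_univ_four] using hp

/-- The corner cell is the image of the cell under the homothety of ratio 1/2 at vertex `i`.
Inverting it turns the weights `l k` into 2 `l k` - δ, nonnegative exactly when `l i` is at least
1/2. -/
theorem Cell.carrier_corner_of_half_le {c : Cell} {l : Fin 4 → ℝ} (hl : ∀ i, 0 ≤ l i)
    (hl1 : ∑ i, l i = 1) {i : Fin 4} (hi : 1 / 2 ≤ l i) :
    ∑ k, l k • c.vert k ∈ (c.corner i).carrier := by
  refine Cell.mem_carrier.2 ⟨fun k => 2 * l k - if k = i then 1 else 0, fun k => ?_, ?_, ?_⟩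
  · dsimp only
    split_ifs with h
    · subst h; linarith
    · linarith [hl k]
  · simp [← Finset.mul_sum, hl1]; norm_num
  · have h : ∀ k, (2 * l k - if k = i then 1 else 0) • (c.corner i).vert k =
        l k • c.vert i + l k • c.vert k - if k = i then c.vert i else 0 := fun k => by
      simp only [Cell.corner, Cell.mid]
      split_ifs with h
      · subst h; module
      · module
    simp_rw [h]
    simp [Finset.sum_add_distrib, ← Finset.sum_smul, hl1]

/-- A point with some weight at least 1/2 lies in a corner. The others lie in the middle octahedron,
where comparing l0 - l1 with ±(l2 - l3) selects one of the four pieces around the diagonal from `mid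
0 1` to `mid 2 3`. -/
theorem Cell.exists_mem_child {c : Cell} {p : E3} (hp : p ∈ c.carrier) :
    ∃ m, p ∈ (c.child m).carrier := by
  obtain ⟨l, hl, hl1, rfl⟩ := Cell.mem_carrier.1 hp
  by_cases hcorner : ∃ i, 1 / 2 ≤ l i
  · obtain ⟨i, hi⟩ := hcorner
    have := Cell.carrier_corner_of_half_le (c := c) hl hl1 hi
    obtain ⟨t, v⟩ := c
    cases t
    · fin_cases i
      exacts [⟨0, this⟩, ⟨1, this⟩, ⟨2, this⟩, ⟨3, this⟩]
    · fin_cases i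
      exacts [⟨4, this⟩, ⟨5, this⟩, ⟨6, this⟩, ⟨7, this⟩]
  push Not at hcorner
  have b0 := hl 0
  have b1 := hl 1
  have b2 := hl 2
  have b3 := hl 3
  have c0 := hcorner 0
  have c1 := hcorner 1
  have c2 := hcorner 2
  have c3 := hcorner 3
  rw [Fin.sum_univ_four] at hl1 ⊢
  generalize l 0 = l0 at *
  generalize l 1 = l1 at *
  generalize l 2 = l2 at *
  have e3 : l 3 = 1 - l0 - l1 - l2 := by linarith
  rw [e3] at b3 c3 ⊢
  clear hl hcorner hl1 e3
  obtain ⟨t, v⟩ := c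
  -- In each case the witnesses are the barycentric coordinates in the selected piece. They are
  -- nonnegative by the two sign conditions and by all weights lying between 0 and 1/2.
  rcases le_total (l0 - l1) (l2 - (1 - l0 - l1 - l2)) with h | h <;>
    rcases le_total (l0 - l1) (-(l2 - (1 - l0 - l1 - l2))) with h' | h' <;> cases t
  · refine ⟨7, Cell.mem_carrier_of_weights (2 * l0) (1 - 2 * l1)
      ((l2 - (1 - l0 - l1 - l2)) - (l0 - l1)) (-(l0 - l1) - (l2 - (1 - l0 - l1 - l2)))
      (by linarith) (by linarith) (by linarith) (by linarith) (by ring) ?_⟩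
    simp [Cell.child, Cell.mid]
    module
  · refine ⟨2, Cell.mem_carrier_of_weights (2 * l0) (1 - 2 * l1)
      (-(l0 - l1) - (l2 - (1 - l0 - l1 - l2))) ((l2 - (1 - l0 - l1 - l2)) - (l0 - l1))
      (by linarith) (by linarith) (by linarith) (by linarith) (by ring) ?_⟩
    simp [Cell.child, Cell.mid]
    module
  · refine ⟨4, Cell.mem_carrier_of_weights ((l2 - (1 - l0 - l1 - l2)) + (l0 - l1)) ((l2 - (1 - l0 - l1 - l2)) - (l0 - l1))
      (2 * (1 - l0 - l1 - l2)) (1 - 2 * l2)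
      (by linarith) (by linarith) (by linarith) (by linarith) (by ring) ?_⟩
    simp [Cell.child, Cell.mid]
    module
  · refine ⟨3, Cell.mem_carrier_of_weights (1 - 2 * l2) (2 * (1 - l0 - l1 - l2))
      ((l2 - (1 - l0 - l1 - l2)) - (l0 - l1)) ((l2 - (1 - l0 - l1 - l2)) + (l0 - l1))
      (by linarith) (by linarith) (by linarith) (by linarith) (by ring) ?_⟩
    simp [Cell.child, Cell.mid]
    module
  · refine ⟨5, Cell.mem_carrier_of_weights ((l0 - l1) - (l2 - (1 - l0 - l1 - l2))) (-(l2 - (1 - l0 - l1 - l2)) - (l0 - l1))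
      (1 - 2 * (1 - l0 - l1 - l2)) (2 * l2)
      (by linarith) (by linarith) (by linarith) (by linarith) (by ring) ?_⟩
    simp [Cell.child, Cell.mid]
    module
  · refine ⟨1, Cell.mem_carrier_of_weights (1 - 2 * (1 - l0 - l1 - l2)) (2 * l2)
      ((l0 - l1) - (l2 - (1 - l0 - l1 - l2))) (-(l2 - (1 - l0 - l1 - l2)) - (l0 - l1))
      (by linarith) (by linarith) (by linarith) (by linarith) (by ring) ?_⟩
    simp [Cell.child, Cell.mid]
    module
  · refine ⟨6, Cell.mem_carrier_of_weights (2 * l1) (1 - 2 * l0)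
      ((l0 - l1) + (l2 - (1 - l0 - l1 - l2))) ((l0 - l1) - (l2 - (1 - l0 - l1 - l2)))
      (by linarith) (by linarith) (by linarith) (by linarith) (by ring) ?_⟩
    simp [Cell.child, Cell.mid]
    module
  · refine ⟨0, Cell.mem_carrier_of_weights (2 * l1) (1 - 2 * l0)
      ((l0 - l1) + (l2 - (1 - l0 - l1 - l2))) ((l0 - l1) - (l2 - (1 - l0 - l1 - l2)))
      (by linarith) (by linarith) (by linarith) (by linarith) (by ring) ?_⟩
    simp [Cell.child, Cell.mid]
    module

/-! ### Volumes of cells and null overlaps. -/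

/-- The determinant of the edge vectors at the vertex `0`. -/
noncomputable def edgeDet (v : Fin 4 → E3) : ℝ :=
  (Matrix.of fun i j : Fin 3 => v j.succ i - v 0 i).det

/-- The tetrahedron spanned by the origin and the standard basis. -/
noncomputable def stdTetrahedron : Set E3 :=
  convexHull ℝ (Set.range (Fin.cons 0 (fun j : Fin 3 => EuclideanSpace.single j 1) : Fin 4 → E3))

/-- The tetrahedron is an affine image of the standard one, whose volume need not be known: only
ratios of volumes matter. -/
theorem volume_convexHull_range (v : Fin 4 → E3) :
    volume (convexHull ℝ (Set.range v)) = ENNReal.ofReal |edgeDet v| * volume stdTetrahedron := by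
  set L : E3 →ₗ[ℝ] E3 := Matrix.toLpLin 2 2 (Matrix.of fun i j : Fin 3 => v j.succ i - v 0 i)
    with hL
  have hdet : LinearMap.det L = edgeDet v := by
    rw [hL, Matrix.toLpLin_eq_toLin, LinearMap.det_toLin]; rfl
  set f : E3 →ᵃ[ℝ] E3 := L.toAffineMap + AffineMap.const ℝ E3 (v 0) with hf
  have hLs : ∀ j : Fin 3, L (EuclideanSpace.single j 1) = v j.succ - v 0 := fun j => by
    ext i
    simp [hL, Matrix.toLpLin_apply]
  have h1 : convexHull ℝ (Set.range v) = f '' stdTetrahedron := by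
    rw [stdTetrahedron, f.image_convexHull, ← Set.range_comp]
    congr 2
    funext i
    refine Fin.cases ?_ (fun j => ?_) i
    · simp [hf]
    · simp [hf, hLs]
  have h2 : f '' stdTetrahedron = (fun p => v 0 + p) '' (L '' stdTetrahedron) := by
    rw [Set.image_image]
    exact Set.image_congr fun p _ => by simp [hf, add_comm]
  rw [h1, h2, ← hdet, Set.image_add_left, measure_preimage_add, Measure.addHaar_image_linearMap]

theorem edgeDet_child (c : Cell) (m : Fin 8) :
    |edgeDet (c.child m).vert| = |edgeDet c.vert| / 8 := by
  -- The sign depends on the orientation given by the order of the vertices of the child.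
  have h : edgeDet (c.child m).vert = edgeDet c.vert / 8 ∨
      edgeDet (c.child m).vert = -(edgeDet c.vert / 8) := by
    obtain ⟨t, v⟩ := c
    cases t <;> fin_cases m <;>
      simp [edgeDet, Matrix.det_fin_three, Cell.child, Cell.mid, Cell.corner] <;>
      first | (left; ring1) | (right; ring1)
  rcases h with h | h <;> simp [h, abs_div]

theorem Cell.volume_child (c : Cell) (m : Fin 8) :
    volume (c.child m).carrier = volume c.carrier / 8 := by
  rw [Cell.carrier, Cell.carrier, volume_convexHull_range, volume_convexHull_range, edgeDet_child,
    ENNReal.ofReal_div_of_pos (by norm_num)]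
  simp [div_eq_mul_inv, mul_right_comm]

theorem Cell.mid_mem (c : Cell) (i k : Fin 4) : c.mid i k ∈ c.carrier := by
  have h := fun i => subset_convexHull ℝ (Set.range c.vert) (Set.mem_range_self i)
  have := convex_convexHull ℝ (Set.range c.vert) (h i) (h k) (a := 1 / 2) (b := 1 / 2)
    (by norm_num) (by norm_num) (by norm_num)
  rwa [← smul_add] at this

theorem Cell.child_vert_mem (c : Cell) (m : Fin 8) (i : Fin 4) :
    (c.child m).vert i ∈ c.carrier := by
  obtain ⟨t, v⟩ := c
  cases t <;> fin_cases m <;> fin_cases i <;> exact Cell.mid_mem ⟨_, v⟩ _ _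

theorem Cell.carrier_child_subset (c : Cell) (m : Fin 8) : (c.child m).carrier ⊆ c.carrier :=
  convexHull_min (by rintro _ ⟨i, rfl⟩; exact c.child_vert_mem m i) (convex_convexHull ℝ _)

theorem Cell.carrier_eq_iUnion (c : Cell) : c.carrier = ⋃ m, (c.child m).carrier :=
  Set.Subset.antisymm (fun _ hp => Set.mem_iUnion.2 (Cell.exists_mem_child hp))
    (Set.iUnion_subset c.carrier_child_subset)

theorem Cell.volume_lt_top (c : Cell) : volume c.carrier < ⊤ :=
  ((Set.finite_range c.vert).isCompact_convexHull ℝ).measure_lt_top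

/-- A finite cover whose measures add up to that of the union is almost everywhere disjoint. -/
theorem pairwise_aedisjoint_of_sum_le {α ι : Type*} [MeasurableSpace α] {μ : Measure α}
    [Fintype ι] {s : ι → Set α} (hs : ∀ i, MeasurableSet (s i))
    (h : ∑ i, μ (s i) ≤ μ (⋃ i, s i)) (hfin : μ (⋃ i, s i) ≠ ⊤) :
    Pairwise (Function.onFun (AEDisjoint μ) s) := by
  classical
  intro i j hij
  set T := (Finset.univ.erase i).erase j with hT
  have hj : j ∈ Finset.univ.erase i := Finset.mem_erase.2 ⟨hij.symm, Finset.mem_univ j⟩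
  have hsum : ∑ k, μ (s k) = μ (s i) + (μ (s j) + ∑ k ∈ T, μ (s k)) := by
    rw [← Finset.add_sum_erase _ _ (Finset.mem_univ i), ← Finset.add_sum_erase _ _ hj]
  have hcov : (⋃ k, s k) ⊆ (s i ∪ s j) ∪ ⋃ k ∈ T, s k := by
    refine Set.iUnion_subset fun k x hx => ?_
    by_cases hki : k = i
    · subst hki; exact Or.inl (Or.inl hx)
    by_cases hkj : k = j
    · subst hkj; exact Or.inl (Or.inr hx)
    · exact Or.inr (Set.mem_biUnion (show k ∈ T by simp [hT, hki, hkj]) hx)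
  have h1 : μ (⋃ k, s k) ≤ μ (s i ∪ s j) + ∑ k ∈ T, μ (s k) :=
    (measure_mono hcov).trans ((measure_union_le _ _).trans
      (add_le_add_right (measure_biUnion_finset_le T s) _))
  have h2 := measure_union_add_inter (μ := μ) (s i) (hs j)
  have hfT : ∑ k, μ (s k) ≠ ⊤ := (h.trans_lt hfin.lt_top).ne
  -- The sum counts the overlap of `s i` and `s j` twice while the union counts it once; the finite
  -- total can then be cancelled.
  have h3 : ∑ k, μ (s k) + μ (s i ∩ s j) ≤ ∑ k, μ (s k) := by
    calc ∑ k, μ (s k) + μ (s i ∩ s j)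
        ≤ (μ (s i ∪ s j) + ∑ k ∈ T, μ (s k)) + μ (s i ∩ s j) :=
          add_le_add_left (h.trans h1) _
      _ = (μ (s i ∪ s j) + μ (s i ∩ s j)) + ∑ k ∈ T, μ (s k) := by ring
      _ = ∑ k, μ (s k) := by rw [h2, hsum]; ring
  have h4 : ∑ k, μ (s k) + μ (s i ∩ s j) ≤ ∑ k, μ (s k) + 0 := by simpa using h3
  exact le_antisymm ((ENNReal.add_le_add_iff_left hfT).1 h4) zero_le

theorem Cell.aedisjoint_child (c : Cell) :
    Pairwise (Function.onFun (AEDisjoint volume) fun m => (c.child m).carrier) := by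
  refine pairwise_aedisjoint_of_sum_le (fun m => measurableSet_carrier _) ?_ ?_
  · rw [← c.carrier_eq_iUnion]
    simp only [c.volume_child, Finset.sum_const, Finset.card_univ, Fintype.card_fin, nsmul_eq_mul]
    rw [Nat.cast_ofNat, ENNReal.mul_div_cancel (by norm_num) (by norm_num)]
  · rw [← c.carrier_eq_iUnion]
    exact c.volume_lt_top.ne

/-! ### Cells shrink under refinement. -/

/-- Bound for the size of a cell, in a form that is passed on to its children. -/
def Cell.SizeLE (c : Cell) (h : ℝ) : Prop :=
  match c.type with
  | .T => ‖c.vert 0 - c.vert 1‖ ≤ 2 * h ∧ ‖(2 : ℝ) • c.vert 2 - c.vert 0 - c.vert 1‖ ≤ 2 * h ∧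
      ‖(2 : ℝ) • c.vert 3 - c.vert 0 - c.vert 1‖ ≤ 2 * h
  | .M => ‖c.vert 0 - c.vert 1 + c.vert 2 - c.vert 3‖ ≤ 2 * h ∧
      ‖c.vert 0 - c.vert 1 - c.vert 2 + c.vert 3‖ ≤ 2 * h ∧
      ‖c.vert 0 + c.vert 1 - c.vert 2 - c.vert 3‖ ≤ 2 * h

theorem norm_le_half {E : Type*} [NormedAddCommGroup E] [NormedSpace ℝ E] {x y : E} {h : ℝ}
    (hx : ‖x‖ ≤ 2 * h) (hy : y = (1 / 2 : ℝ) • x ∨ y = (-(1 / 2) : ℝ) • x) :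
    ‖y‖ ≤ 2 * (h / 2) := by
  rcases hy with rfl | rfl <;> rw [norm_smul] <;> norm_num <;> linarith

/-- The three vectors attached to a child are, up to sign and order, the halves of those of its
parent, whichever types occur. -/
theorem Cell.SizeLE.child {c : Cell} {h : ℝ} (hc : c.SizeLE h) (m : Fin 8) :
    (c.child m).SizeLE (h / 2) := by
  obtain ⟨t, v⟩ := c
  cases t <;> obtain ⟨h1, h2, h3⟩ := hc <;> dsimp only at h1 h2 h3 <;> fin_cases m <;>
    refine ⟨?_, ?_, ?_⟩ <;>
    simp [Cell.child, Cell.corner, Cell.mid] <;>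
    first
    | exact norm_le_half h1 (Or.inl (by module))
    | exact norm_le_half h1 (Or.inr (by module))
    | exact norm_le_half h2 (Or.inl (by module))
    | exact norm_le_half h2 (Or.inr (by module))
    | exact norm_le_half h3 (Or.inl (by module))
    | exact norm_le_half h3 (Or.inr (by module))

theorem norm_le_of_half_add {E : Type*} [NormedAddCommGroup E] [NormedSpace ℝ E] {x y z : E}
    {h : ℝ} (hx : ‖x‖ ≤ 2 * h) (hy : ‖y‖ ≤ 2 * h) (hz : z = (1 / 2 : ℝ) • (x + y)) :
    ‖z‖ ≤ 2 * h := by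
  rw [hz, norm_smul]
  have := norm_add_le x y
  norm_num
  linarith

/-- By convexity of the ball only vertices matter. Each edge at vertex 0 is one of the three vectors
or, up to signs, half the sum of two of them. -/
theorem Cell.SizeLE.carrier_subset {c : Cell} {h : ℝ} (hc : c.SizeLE h) :
    c.carrier ⊆ Metric.closedBall (c.vert 0) (2 * h) := by
  refine convexHull_min ?_ (convex_closedBall _ _)
  rintro _ ⟨i, rfl⟩
  rw [mem_closedBall_iff_norm']
  obtain ⟨t, v⟩ := c
  cases t <;> obtain ⟨h1, h2, h3⟩ := hc <;> dsimp only at h1 h2 h3 ⊢ <;> fin_cases i <;>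
    dsimp only [Fin.zero_eta, Fin.mk_one, Fin.reduceFinMk]
  · simpa using (norm_nonneg _).trans h1
  · exact h1
  · rw [← norm_neg] at h2
    exact norm_le_of_half_add h1 h2 (by module)
  · rw [← norm_neg] at h3
    exact norm_le_of_half_add h1 h3 (by module)
  · simpa using (norm_nonneg _).trans h1
  · exact norm_le_of_half_add h1 h2 (by module)
  · exact norm_le_of_half_add h2 h3 (by module)
  · exact norm_le_of_half_add h1 h3 (by module)

/-! ### The grid on the octahedron. -/

noncomputable instance Idx.fintype : ∀ j, Fintype (Idx j)
  | 0 => inferInstanceAs (Fintype (Fin 4))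
  | j + 1 => letI := Idx.fintype j; inferInstanceAs (Fintype (Idx j × Fin 8))

theorem halfDiag_pos {r : ℝ} (hr : 0 < r) : 0 < halfDiag r := mul_pos hr pi_third_pos

theorem sq_signX (i : Fin 4) : signX i ^ 2 = 1 := by fin_cases i <;> simp [signX]

theorem sq_signY (i : Fin 4) : signY i ^ 2 = 1 := by fin_cases i <;> simp [signY]

theorem exists_mem_rootCell {r : ℝ} (hr : 0 < r) {p : E3} (hp : p ∈ octahedron r) :
    ∃ i, p ∈ (rootCell r i).carrier := by
  have ha := halfDiag_pos hr
  have hp' : |p 0| + |p 1| + |p 2| ≤ halfDiag r := hp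
  have hi : ∃ i, signX i * p 0 = |p 0| ∧ signY i * p 1 = |p 1| := by
    rcases le_total 0 (p 0) with h0 | h0 <;> rcases le_total 0 (p 1) with h1 | h1
    · exact ⟨0, by simp [signX, signY, abs_of_nonneg, h0, h1]⟩
    · exact ⟨3, by simp [signX, signY, abs_of_nonneg, abs_of_nonpos, h0, h1]⟩
    · exact ⟨1, by simp [signX, signY, abs_of_nonneg, abs_of_nonpos, h0, h1]⟩
    · exact ⟨2, by simp [signX, signY, abs_of_nonpos, h0, h1]⟩
  obtain ⟨i, hx, hy⟩ := hi
  set a := halfDiag r with hadef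
  have hz := neg_abs_le (p 2)
  have hz' := le_abs_self (p 2)
  -- The weights at (±a,0,0) and (0,±a,0) are forced by x and y; the two apex weights share the rest
  -- so that their difference is z/a.
  refine ⟨i, Cell.mem_carrier_of_weights ((a - |p 0| - |p 1| + p 2) / (2 * a))
    ((a - |p 0| - |p 1| - p 2) / (2 * a)) (|p 0| / a) (|p 1| / a)
    (div_nonneg (by linarith) (by positivity)) (div_nonneg (by linarith) (by positivity))
    (by positivity) (by positivity) (by field_simp; ring) ?_⟩
  rw [← hx, ← hy]
  ext k
  fin_cases k
  · simp [rootCell, ← hadef]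
    field_simp
    rw [sq_signX, one_mul]
  · simp [rootCell, ← hadef]
    field_simp
    rw [sq_signY, one_mul]
  · simp [rootCell, ← hadef]
    field_simp
    ring

theorem mem_rootCell {r : ℝ} (hr : 0 < r) {i : Fin 4} {p : E3} (hp : p ∈ (rootCell r i).carrier) :
    0 ≤ signX i * p 0 ∧ 0 ≤ signY i * p 1 ∧ p ∈ octahedron r := by
  have ha := halfDiag_pos hr
  obtain ⟨l, hl, hl1, rfl⟩ := Cell.mem_carrier.1 hp
  have b0 := hl 0
  have b1 := hl 1
  have b2 := hl 2
  have b3 := hl 3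
  rw [Fin.sum_univ_four] at hl1
  have hx : (∑ i_1, l i_1 • (rootCell r i).vert i_1) 0 = signX i * (l 2 * halfDiag r) := by
    simp [Fin.sum_univ_four, rootCell]; ring
  have hy : (∑ i_1, l i_1 • (rootCell r i).vert i_1) 1 = signY i * (l 3 * halfDiag r) := by
    simp [Fin.sum_univ_four, rootCell]; ring
  have hz : (∑ i_1, l i_1 • (rootCell r i).vert i_1) 2 = (l 0 - l 1) * halfDiag r := by
    simp [Fin.sum_univ_four, rootCell]; ring
  have hsx : |signX i| = 1 :=
    (pow_eq_one_iff_of_nonneg (abs_nonneg _) two_ne_zero).1 (by rw [sq_abs, sq_signX])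
  have hsy : |signY i| = 1 :=
    (pow_eq_one_iff_of_nonneg (abs_nonneg _) two_ne_zero).1 (by rw [sq_abs, sq_signY])
  refine ⟨?_, ?_, ?_⟩
  · rw [hx, ← mul_assoc, ← sq, sq_signX]; positivity
  · rw [hy, ← mul_assoc, ← sq, sq_signY]; positivity
  · rw [octahedron, Set.mem_ofPred_eq, hx, hy, hz, abs_mul, abs_mul, abs_mul, abs_mul, abs_mul, hsx,
      hsy, abs_of_pos ha, abs_of_nonneg b2, abs_of_nonneg b3]
    have : |l 0 - l 1| ≤ l 0 + l 1 := abs_le.2 ⟨by linarith, by linarith⟩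
    nlinarith

theorem octahedron_eq_iUnion {r : ℝ} (hr : 0 < r) :
    octahedron r = ⋃ i, (rootCell r i).carrier :=
  Set.Subset.antisymm (fun _ hp => Set.mem_iUnion.2 (exists_mem_rootCell hr hp))
    (Set.iUnion_subset fun _ _ hp => (mem_rootCell hr hp).2.2)

theorem volume_coord_plane (i : Fin 3) : volume {p : E3 | p i = 0} = 0 := by
  have h := (PiLp.volume_preserving_ofLp (Fin 3)).measure_preimage
    (measurableSet_eq_fun (measurable_pi_apply i) measurable_const).nullMeasurableSet
    (s := {q : Fin 3 → ℝ | q i = 0})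
  rw [volume_coord_eq_zero] at h
  exact h

theorem aedisjoint_rootCell {r : ℝ} (hr : 0 < r) :
    Pairwise (Function.onFun (AEDisjoint volume) fun i => (rootCell r i).carrier) := by
  intro i k hik
  -- Two different vertical quarters have opposite signs of x or of y, so they meet only in a
  -- coordinate plane.
  refine measure_mono_null (t := {p : E3 | p 0 = 0} ∪ {p : E3 | p 1 = 0}) ?_
    (measure_union_null (volume_coord_plane 0) (volume_coord_plane 1))
  rintro p ⟨hi, hk⟩
  obtain ⟨hi0, hi1, -⟩ := mem_rootCell hr hi
  obtain ⟨hk0, hk1, -⟩ := mem_rootCell hr hk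
  revert hik hi0 hi1 hk0 hk1
  fin_cases i <;> fin_cases k <;> simp [signX, signY] <;> intros <;>
    first
    | (left; linarith)
    | (right; linarith)

theorem volume_rootCell (r : ℝ) (i : Fin 4) :
    volume (rootCell r i).carrier = volume (rootCell r 0).carrier := by
  rw [Cell.carrier, Cell.carrier, volume_convexHull_range, volume_convexHull_range]
  congr 2
  fin_cases i <;> simp [edgeDet, Matrix.det_fin_three, rootCell, signX, signY]

theorem measurableSet_octahedron (r : ℝ) : MeasurableSet (octahedron r) := by
  have h : Measurable fun p : E3 => |p 0| + |p 1| + |p 2| := by fun_prop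
  exact measurableSet_le h measurable_const

theorem volume_octahedron_eq {r : ℝ} (hr : 0 < r) (i : Fin 4) :
    volume (octahedron r) = 4 * volume (rootCell r i).carrier := by
  rw [octahedron_eq_iUnion hr, measure_iUnion₀ (aedisjoint_rootCell hr)
    fun i => (measurableSet_carrier _).nullMeasurableSet]
  simp [tsum_fintype, volume_rootCell r i, volume_rootCell r, Finset.sum_const]

theorem volume_octahedron_ne_top (r : ℝ) : volume (octahedron r) ≠ ⊤ :=
  isFiniteMeasure_restrict.1 (isFiniteMeasure_octahedron r)

theorem volume_octahedron_pos {r : ℝ} (hr : 0 < r) : 0 < volume.real (octahedron r) := by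
  refine ENNReal.toReal_pos ?_ (volume_octahedron_ne_top r)
  -- Positivity is inherited from the ball, which has the same volume.
  rw [← measurePreserving_mapU.measure_preimage (measurableSet_octahedron r).nullMeasurableSet,
    mapU_preimage_octahedron]
  exact (Metric.measure_closedBall_pos volume 0 hr).ne'

theorem volume_cell {r : ℝ} (hr : 0 < r) : ∀ (j : ℕ) (k : Idx j),
    volume (octahedron r) = 4 * 8 ^ j * volume (cell r j k).carrier
  | 0, k => by
    rw [pow_zero, mul_one]
    exact volume_octahedron_eq hr k
  | j + 1, k => by
    rw [volume_cell hr j k.1, cell, Cell.volume_child, pow_succ, mul_assoc (4 : ENNReal) (8 ^ j * 8),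
      mul_assoc (8 ^ j : ENNReal), ENNReal.mul_div_cancel (by norm_num) (by norm_num), mul_assoc]

theorem volume_real_cell {r : ℝ} (hr : 0 < r) (j : ℕ) (k : Idx j) :
    volume.real (octahedron r) = 4 * 8 ^ j * volume.real (cell r j k).carrier := by
  have := congrArg ENNReal.toReal (volume_cell hr j k)
  simpa [Measure.real] using this

theorem aedisjoint_cell {r : ℝ} (hr : 0 < r) : ∀ j : ℕ,
    Pairwise (Function.onFun (AEDisjoint volume) fun k => (cell r j k).carrier)
  | 0 => aedisjoint_rootCell hr
  | j + 1 => by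
    rintro ⟨k, m⟩ ⟨k', m'⟩ h
    by_cases hk : k = k'
    · subst hk
      exact Cell.aedisjoint_child _ fun hm => h (congrArg (Prod.mk k) hm)
    · exact (aedisjoint_cell hr j hk).mono (Cell.carrier_child_subset _ _)
        (Cell.carrier_child_subset _ _)

theorem exists_mem_cell {r : ℝ} (hr : 0 < r) {p : E3} (hp : p ∈ octahedron r) :
    ∀ j : ℕ, ∃ k, p ∈ (cell r j k).carrier
  | 0 => exists_mem_rootCell hr hp
  | j + 1 => by
    obtain ⟨k, hk⟩ := exists_mem_cell hr hp j
    obtain ⟨m, hm⟩ := Cell.exists_mem_child hk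
    exact ⟨(k, m), hm⟩

theorem carrier_cell_subset {r : ℝ} (hr : 0 < r) : ∀ (j : ℕ) (k : Idx j),
    (cell r j k).carrier ⊆ octahedron r
  | 0, _ => fun _ hp => (mem_rootCell hr hp).2.2
  | j + 1, k => (Cell.carrier_child_subset _ _).trans (carrier_cell_subset hr j k.1)

theorem sizeLE_rootCell {r : ℝ} (hr : 0 < r) (i : Fin 4) : (rootCell r i).SizeLE (halfDiag r) := by
  have ha := halfDiag_pos hr
  refine ⟨?_, ?_, ?_⟩
  · simp only [rootCell]
    rw [EuclideanSpace.norm_eq, Real.sqrt_le_left (by positivity)]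
    simp [Fin.sum_univ_three]
    exact le_of_eq (by ring)
  · simp only [rootCell]
    rw [EuclideanSpace.norm_eq, Real.sqrt_le_left (by positivity)]
    simp [Fin.sum_univ_three, mul_pow, sq_signX]
  · simp only [rootCell]
    rw [EuclideanSpace.norm_eq, Real.sqrt_le_left (by positivity)]
    simp [Fin.sum_univ_three, mul_pow, sq_signY]

theorem sizeLE_cell {r : ℝ} (hr : 0 < r) : ∀ (j : ℕ) (k : Idx j),
    (cell r j k).SizeLE (halfDiag r / 2 ^ j)
  | 0, i => by
    rw [pow_zero, div_one]
    exact sizeLE_rootCell hr i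
  | j + 1, k => by
    have := (sizeLE_cell hr j k.1).child k.2
    rwa [div_div, ← pow_succ] at this

/-! ### Scaling functions in L² of the octahedron: orthonormality, refinement, density. -/

section

theorem toLp_sum_mul {α ι 𝕜 : Type*} [MeasurableSpace α] [RCLike 𝕜] {μ : Measure α}
    (s : Finset ι) (c : ι → 𝕜) (f : ι → α → 𝕜) (hf : ∀ i, MemLp (f i) 2 μ)
    (h : MemLp (fun p => ∑ i ∈ s, c i * f i p) 2 μ) :
    h.toLp _ = ∑ i ∈ s, c i • (hf i).toLp (f i) := by
  classical
  induction s using Finset.induction_on with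
  | empty =>
    rw [Lp.ext_iff]
    filter_upwards [h.coeFn_toLp, Lp.coeFn_zero 𝕜 2 μ] with x hx hx0
    rw [hx, Finset.sum_empty, Finset.sum_empty]
    exact hx0.symm
  | insert a s ha ih =>
    have h' : MemLp (fun p => ∑ i ∈ s, c i * f i p) 2 μ :=
      memLp_finsetSum s fun i _ => (hf i).const_mul (c i)
    rw [Finset.sum_insert ha, ← ih h', ← MemLp.toLp_const_smul (c a) (hf a), ← MemLp.toLp_add]
    refine MemLp.toLp_congr _ _ (Filter.Eventually.of_forall fun p => ?_)
    simp [Finset.sum_insert ha]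

/-- The value of the scaling functions of level `j` on their cells. -/
noncomputable def scaleCoeff (r : ℝ) (j : ℕ) : ℝ :=
  (2 * Real.sqrt 2) ^ j * (2 / Real.sqrt (volume.real (octahedron r)))

theorem scaleCoeff_pos {r : ℝ} (hr : 0 < r) (j : ℕ) : 0 < scaleCoeff r j := by
  have := volume_octahedron_pos hr
  unfold scaleCoeff
  positivity

theorem scaleCoeff_succ (r : ℝ) (j : ℕ) :
    scaleCoeff r j = 1 / (2 * Real.sqrt 2) * scaleCoeff r (j + 1) := by
  have : (0 : ℝ) < Real.sqrt 2 := by positivity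
  unfold scaleCoeff
  rw [pow_succ]
  field_simp

variable {𝕜 : Type*} [RCLike 𝕜]

theorem scaling_of_mem {r : ℝ} {j : ℕ} {k : Idx j} {p : E3} (h : p ∈ (cell r j k).carrier) :
    scaling 𝕜 r j k p = (scaleCoeff r j : ℝ) := Set.indicator_of_mem h _

theorem scaling_of_notMem {r : ℝ} {j : ℕ} {k : Idx j} {p : E3} (h : p ∉ (cell r j k).carrier) :
    scaling 𝕜 r j k p = 0 := Set.indicator_of_notMem h _

theorem ae_cell_unique {r : ℝ} (hr : 0 < r) (j : ℕ) :
    ∀ᵐ p : E3, ∀ k k', p ∈ (cell r j k).carrier → p ∈ (cell r j k').carrier → k = k' := by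
  rw [ae_all_iff]
  intro k
  rw [ae_all_iff]
  intro k'
  by_cases h : k = k'
  · exact Filter.Eventually.of_forall fun _ _ _ => h
  · filter_upwards [measure_eq_zero_iff_ae_notMem.1 (aedisjoint_cell hr j h)] with p hp hk hk'
    exact absurd ⟨hk, hk'⟩ hp

theorem scalingK_eq_indicatorConstLp (r : ℝ) (j : ℕ) (k : Idx j) :
    scalingK 𝕜 r j k = indicatorConstLp 2 (measurableSet_carrier (cell r j k))
      (measure_ne_top (volume.restrict (octahedron r)) _) ((scaleCoeff r j : ℝ) : 𝕜) := rfl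

/-- Since (2√2)² = 8, the squared coefficient is 4·8^j / vol K, the reciprocal of the volume of a
cell of level j. Distinct cells overlap in null sets. -/
theorem orthonormal_scalingK {r : ℝ} (hr : 0 < r) (j : ℕ) : Orthonormal 𝕜 (scalingK 𝕜 r j) := by
  classical
  rw [orthonormal_iff_ite]
  intro k k'
  rw [scalingK_eq_indicatorConstLp, scalingK_eq_indicatorConstLp,
    L2.inner_indicatorConstLp_indicatorConstLp]
  split_ifs with h
  · subst h
    rw [Set.inter_self, measureReal_restrict_apply (measurableSet_carrier _),
      Set.inter_eq_left.2 (carrier_cell_subset hr j k)]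
    have h1 := volume_real_cell hr j k
    have h2 := volume_octahedron_pos hr
    have h3 : volume.real (cell r j k).carrier * (scaleCoeff r j * scaleCoeff r j) = 1 := by
      have h4 : scaleCoeff r j * scaleCoeff r j =
          4 * 8 ^ j / volume.real (octahedron r) := by
        unfold scaleCoeff
        have h5 : Real.sqrt (volume.real (octahedron r)) ^ 2 = _ := Real.sq_sqrt h2.le
        have h6 : (2 * Real.sqrt 2) ^ j * (2 * Real.sqrt 2) ^ j = (8 : ℝ) ^ j := by
          rw [← mul_pow]
          congr 1
          nlinarith [Real.mul_self_sqrt (show (0 : ℝ) ≤ 2 by norm_num)]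
        rw [mul_mul_mul_comm, h6, div_mul_div_comm, ← sq (Real.sqrt _), h5]
        ring
      have h7 : (0 : ℝ) < 4 * 8 ^ j := by positivity
      rw [h4]
      rw [h1] at h2 ⊢
      have h8 : volume.real (cell r j k).carrier ≠ 0 := fun h0 => by simp [h0] at h2
      field_simp
    rw [RCLike.inner_apply, RCLike.conj_ofReal, RCLike.real_smul_eq_coe_mul]
    exact_mod_cast h3
  · have : volume.restrict (octahedron r) ((cell r j k).carrier ∩ (cell r j k').carrier) = 0 :=
      Measure.restrict_le_self.absolutelyContinuous (aedisjoint_cell hr j h)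
    rw [Measure.real, this]
    simp

/-- Almost every point of a cell lies in exactly one child. The identity fails pointwise on shared
faces, so it holds only between classes. -/
theorem scalingK_refine {r : ℝ} (hr : 0 < r) (j : ℕ) (k : Idx j) :
    scalingK 𝕜 r j k =
      ∑ m : Fin 8, ((1 / (2 * Real.sqrt 2) : ℝ) : 𝕜) • scalingK 𝕜 r (j + 1) (k, m) := by
  have hm := fun m : Fin 8 => memLp_scaling 𝕜 (volume.restrict (octahedron r)) r (j + 1) (k, m)
  have hs : MemLp (fun p => ∑ m : Fin 8, ((1 / (2 * Real.sqrt 2) : ℝ) : 𝕜) *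
      scaling 𝕜 r (j + 1) (k, m) p) 2 (volume.restrict (octahedron r)) :=
    memLp_finsetSum _ fun m _ => (hm m).const_mul _
  refine Eq.trans (MemLp.toLp_congr _ hs ?_) (toLp_sum_mul _ _ _ hm hs)
  filter_upwards [ae_restrict_of_ae (ae_cell_unique hr (j + 1))] with p hp
  by_cases hk : p ∈ (cell r j k).carrier
  · obtain ⟨m, hmem⟩ := Cell.exists_mem_child hk
    have hm1 : scaling 𝕜 r (j + 1) (k, m) p = (scaleCoeff r (j + 1) : ℝ) :=
      
      scaling_of_mem (j := j + 1) (k := ((k, m) : Idx j × Fin 8)) hmem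
    rw [Finset.sum_eq_single m, scaling_of_mem hk, scaleCoeff_succ, hm1]
    · push_cast; rfl
    · intro m' _ hne
      refine mul_eq_zero_of_right _
        (scaling_of_notMem (j := j + 1) (k := ((k, m') : Idx j × Fin 8)) fun hmem' => ?_)
      exact hne (congrArg Prod.snd (hp (k, m') (k, m) hmem' hmem))
    · simp
  · rw [scaling_of_notMem hk]
    refine (Finset.sum_eq_zero fun m _ => ?_).symm
    exact mul_eq_zero_of_right _
      (scaling_of_notMem (j := j + 1) (k := ((k, m) : Idx j × Fin 8))
        fun h => hk (Cell.carrier_child_subset _ m h))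

theorem spaceK_mono {r : ℝ} (hr : 0 < r) (j : ℕ) : spaceK 𝕜 r j ≤ spaceK 𝕜 r (j + 1) := by
  refine Submodule.span_le.2 ?_
  rintro _ ⟨k, rfl⟩
  rw [scalingK_refine hr]
  exact Submodule.sum_mem _ fun m _ => Submodule.smul_mem _ _ (Submodule.subset_span ⟨(k, m), rfl⟩)

/-- Uniformly continuous functions are approximated by step functions on a fine grid. -/
theorem exists_mem_spaceK_of_uniformContinuous {r : ℝ} (hr : 0 < r) {g : E3 → 𝕜}
    (hg : UniformContinuous g) (hm : MemLp g 2 (volume.restrict (octahedron r))) {ε : ℝ}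
    (hε : 0 < ε) : ∃ j, ∃ h ∈ spaceK 𝕜 r j, ‖hm.toLp g - h‖ ≤ ε := by
  -- C is the square root of vol K, the factor between a uniform bound and an L² bound. Dividing ε
  -- by C + 1 keeps the total at most ε.
  set C : ℝ := measureUnivNNReal (volume.restrict (octahedron r)) ^ (2 : ENNReal).toReal⁻¹ with hC
  have hC0 : 0 ≤ C := by positivity
  obtain ⟨δ, hδ, hgδ⟩ := Metric.uniformContinuous_iff.1 hg (ε / (C + 1)) (by positivity)
  have ha := halfDiag_pos hr
  obtain ⟨j, hj⟩ : ∃ j : ℕ, 2 * (halfDiag r / 2 ^ j) < δ := by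
    obtain ⟨j, hj⟩ := exists_pow_lt_of_lt_one (show 0 < δ / (2 * halfDiag r) by positivity)
      (show (1 / 2 : ℝ) < 1 by norm_num)
    refine ⟨j, ?_⟩
    rw [lt_div_iff₀ (by positivity)] at hj
    calc 2 * (halfDiag r / 2 ^ j) = (1 / 2) ^ j * (2 * halfDiag r) := by
          rw [one_div, inv_pow]; ring
      _ < δ := hj
  -- The approximant takes on each cell the value of `g` at its vertex 0.
  set c : Idx j → 𝕜 := fun k => g ((cell r j k).vert 0) / ((scaleCoeff r j : ℝ) : 𝕜) with hc
  have hs := fun k => memLp_scaling 𝕜 (volume.restrict (octahedron r)) r j k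
  have hsum : MemLp (fun p => ∑ k, c k * scaling 𝕜 r j k p) 2 (volume.restrict (octahedron r)) :=
    memLp_finsetSum _ fun k _ => (hs k).const_mul _
  refine ⟨j, hsum.toLp _, ?_, ?_⟩
  · rw [toLp_sum_mul _ _ _ hs]
    exact Submodule.sum_mem _ fun k _ => Submodule.smul_mem _ _ (Submodule.subset_span ⟨k, rfl⟩)
  · have hbound : ‖hm.toLp g - hsum.toLp _‖ ≤ C * (ε / (C + 1)) := by
      refine Lp.norm_le_of_ae_bound (by positivity) ?_
      rw [← MemLp.toLp_sub]
      filter_upwards [(hm.sub hsum).coeFn_toLp, ae_restrict_of_ae (ae_cell_unique hr j),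
        ae_restrict_mem (measurableSet_octahedron r)] with p h1 h2 h3
      obtain ⟨k, hk⟩ := exists_mem_cell hr h3 j
      have h4 : ∑ k', c k' * scaling 𝕜 r j k' p = g ((cell r j k).vert 0) := by
        rw [Finset.sum_eq_single k, scaling_of_mem hk, hc]
        · have : ((scaleCoeff r j : ℝ) : 𝕜) ≠ 0 := by
            exact_mod_cast (scaleCoeff_pos hr j).ne'
          field_simp
        · intro k' _ hne
          rw [scaling_of_notMem fun h => hne (h2 k' k h hk), mul_zero]
        · simp
      rw [h1, Pi.sub_apply, h4, ← dist_eq_norm]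
      have h5 := (sizeLE_cell hr j k).carrier_subset hk
      exact (hgδ ((Metric.mem_closedBall.1 h5).trans_lt hj)).le
    refine hbound.trans ?_
    rw [mul_div_assoc', div_le_iff₀ (by positivity)]
    nlinarith

/-- Continuous functions of compact support are dense in L² and uniformly continuous. The errors ε/2
and ε/3 add up to strictly less than ε. -/
theorem dense_spaceK {r : ℝ} (hr : 0 < r) :
    closure (⋃ j, (spaceK 𝕜 r j : Set (L2 𝕜 (octahedron r)))) = Set.univ := by
  refine Set.eq_univ_of_forall fun f => Metric.mem_closure_iff.2 fun ε hε => ?_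
  obtain ⟨g, hgs, hfg, hgc, hg⟩ := (Lp.memLp f).exists_hasCompactSupport_eLpNorm_sub_le
    (by norm_num) (ε := ENNReal.ofReal (ε / 2)) (by simpa using hε)
  obtain ⟨j, h, hj, hh⟩ := exists_mem_spaceK_of_uniformContinuous hr
    (hgs.uniformContinuous_of_continuous hgc) hg (show 0 < ε / 3 by positivity)
  refine ⟨h, Set.mem_iUnion.2 ⟨j, hj⟩, ?_⟩
  have h1 : dist f (hg.toLp g) ≤ ε / 2 := by
    rw [dist_edist, ← Lp.toLp_coeFn f (Lp.memLp f), Lp.edist_toLp_toLp]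
    exact ENNReal.toReal_le_of_le_ofReal (by positivity) hfg
  calc dist f h ≤ dist f (hg.toLp g) + dist (hg.toLp g) h := dist_triangle _ _ _
    _ < ε := by rw [dist_eq_norm (hg.toLp g)]; linarith

end

/-! ### Orthogonal changes of basis, and transport to the ball. -/

section

section LinearAlgebra

variable {𝕜 H ι : Type*} [RCLike 𝕜] [NormedAddCommGroup H] [InnerProductSpace 𝕜 H]

/-- Blockwise change of an orthonormal family by real matrices. -/
noncomputable def blockRows {n : ℕ} (a : ι → Matrix (Fin n) (Fin n) ℝ) (b : ι × Fin n → H)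
    (i : ι × Fin n) : H :=
  ∑ m, (a i.1 i.2 m : 𝕜) • b (i.1, m)

theorem orthonormal_blockRows {n : ℕ} {a : ι → Matrix (Fin n) (Fin n) ℝ}
    (ha : ∀ k, a k ∈ Matrix.orthogonalGroup (Fin n) ℝ) {b : ι × Fin n → H}
    (hb : Orthonormal 𝕜 b) : Orthonormal 𝕜 (blockRows (𝕜 := 𝕜) a b) := by
  classical
  rw [orthonormal_iff_ite] at hb ⊢
  rintro ⟨k, l⟩ ⟨k', l'⟩
  simp only [blockRows, sum_inner, inner_sum, inner_smul_left, inner_smul_right, hb,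
    RCLike.conj_ofReal, Prod.mk.injEq]
  by_cases h : k = k'
  · subst h
    have h1 := congrFun (congrFun ((Matrix.mem_orthogonalGroup_iff _ _).1 (ha k)) l) l'
    rw [Matrix.mul_apply] at h1
    simp only [true_and, mul_ite, mul_one, mul_zero, Finset.sum_ite_eq', Finset.mem_univ, if_true]
    have h2 : ∑ m, (a k l' m : 𝕜) * (a k l m : 𝕜) = ((∑ m, a k l m * a k l' m : ℝ) : 𝕜) := by
      push_cast
      exact Finset.sum_congr rfl fun m _ => mul_comm _ _
    rw [h2]
    simp only [Matrix.transpose_apply, Matrix.one_apply] at h1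
    rw [h1]
    split_ifs <;> simp
  · simp [h]

/-- Orthonormality of the new family uses the rows of the matrices; recovering the old family from
it uses the columns. -/
theorem eq_sum_blockRows {n : ℕ} {a : ι → Matrix (Fin n) (Fin n) ℝ}
    (ha : ∀ k, a k ∈ Matrix.orthogonalGroup (Fin n) ℝ) (b : ι × Fin n → H) (k : ι) (m : Fin n) :
    b (k, m) = ∑ l, (a k l m : 𝕜) • blockRows (𝕜 := 𝕜) a b (k, l) := by
  have h (m' : Fin n) : ∑ l, (a k l m : 𝕜) * (a k l m' : 𝕜) = if m = m' then 1 else 0 := by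
    have h1 := congrFun (congrFun ((Matrix.mem_orthogonalGroup_iff' _ _).1 (ha k)) m) m'
    rw [Matrix.mul_apply] at h1
    simp only [Matrix.transpose_apply, Matrix.one_apply] at h1
    have h2 : ∑ l, (a k l m : 𝕜) * (a k l m' : 𝕜) = ((∑ l, a k l m * a k l m' : ℝ) : 𝕜) := by
      push_cast; rfl
    rw [h2, h1]
    split_ifs <;> simp
  simp only [blockRows, Finset.smul_sum, smul_smul]
  rw [Finset.sum_comm]
  simp [← Finset.sum_smul, h]

/-- The rows with index 0 and the remaining rows span orthogonal subspaces V and W whose sum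
contains the span of `b`, so W is the complement of V in that span. -/
theorem isOrthonormalBasisOf_blockRows {n : ℕ}
    {a : ι → Matrix (Fin (n + 1)) (Fin (n + 1)) ℝ}
    (ha : ∀ k, a k ∈ Matrix.orthogonalGroup (Fin (n + 1)) ℝ) {b : ι × Fin (n + 1) → H}
    (hb : Orthonormal 𝕜 b) :
    IsOrthonormalBasisOf (𝕜 := 𝕜) (fun i : ι × Fin n => blockRows (𝕜 := 𝕜) a b (i.1, i.2.succ))
      ((Submodule.span 𝕜 (Set.range fun k => blockRows (𝕜 := 𝕜) a b (k, 0)))ᗮ ⊓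
        Submodule.span 𝕜 (Set.range b)) := by
  have hχ := orthonormal_blockRows ha hb
  have hinj : Function.Injective fun i : ι × Fin n => (i.1, i.2.succ) := by
    rintro ⟨k, l⟩ ⟨k', l'⟩ h
    simp only [Prod.mk.injEq, Fin.succ_inj] at h
    exact Prod.ext h.1 h.2
  refine ⟨hχ.comp _ hinj, ?_⟩
  set V := Submodule.span 𝕜 (Set.range fun k => blockRows (𝕜 := 𝕜) a b (k, 0)) with hV
  set W := Submodule.span 𝕜
    (Set.range fun i : ι × Fin n => blockRows (𝕜 := 𝕜) a b (i.1, i.2.succ)) with hW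
  have hWV : W ≤ Vᗮ := by
    rw [← Submodule.isOrtho_iff_le, Submodule.isOrtho_comm, Submodule.isOrtho_span]
    rintro _ ⟨k, rfl⟩ _ ⟨i, rfl⟩
    exact hχ.2 fun h => (Fin.succ_ne_zero i.2) (congrArg Prod.snd h).symm
  have hWb : W ≤ Submodule.span 𝕜 (Set.range b) := by
    refine Submodule.span_le.2 ?_
    rintro _ ⟨i, rfl⟩
    exact Submodule.sum_mem _ fun m _ =>
      Submodule.smul_mem _ _ (Submodule.subset_span ⟨_, rfl⟩)
  have hsup : Submodule.span 𝕜 (Set.range b) ≤ V ⊔ W := by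
    refine Submodule.span_le.2 ?_
    rintro _ ⟨⟨k, m⟩, rfl⟩
    rw [eq_sum_blockRows (𝕜 := 𝕜) ha b k m]
    refine Submodule.sum_mem _ fun l _ => Submodule.smul_mem _ _ ?_
    refine Fin.cases ?_ (fun l => ?_) l
    · exact Submodule.mem_sup_left (Submodule.subset_span ⟨k, rfl⟩)
    · exact Submodule.mem_sup_right (Submodule.subset_span ⟨(k, l), rfl⟩)
  refine le_antisymm (le_inf hWV hWb) ?_
  rintro f ⟨hfV, hfb⟩
  obtain ⟨v, hv, w, hw, rfl⟩ := Submodule.mem_sup.1 (hsup hfb)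
  -- Here v = f - w is a difference of two vectors orthogonal to V; lying in V as well, it vanishes.
  have hv' : v ∈ Vᗮ := by simpa using Submodule.sub_mem _ hfV (hWV hw)
  have hv0 : v = 0 := by
    rw [← Submodule.mem_bot 𝕜, ← Submodule.inf_orthogonal_eq_bot V]
    exact ⟨hv, hv'⟩
  simpa [hv0] using hw

theorem map_waveletSpace {H' : Type*} [NormedAddCommGroup H'] [InnerProductSpace 𝕜 H']
    (T : H ≃ₗᵢ[𝕜] H') (V : ℕ → Submodule 𝕜 H) (j : ℕ) :
    (waveletSpace V j).map T.toLinearEquiv.toLinearMap =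
      waveletSpace (fun j => (V j).map T.toLinearEquiv.toLinearMap) j := by
  rw [waveletSpace, waveletSpace, Submodule.map_inf _ T.injective]
  congr 1
  exact Submodule.map_orthogonal_equiv _ T

end LinearAlgebra

variable (𝕜 : Type*) [RCLike 𝕜]

theorem compMeasurePreserving_toLp {α β : Type*} [MeasurableSpace α] [MeasurableSpace β]
    {μ : Measure α} {ν : Measure β} {f : α → β} (hf : MeasurePreserving f μ ν) {g : β → 𝕜}
    (hg : MemLp g 2 ν) :
    Lp.compMeasurePreserving f hf (hg.toLp g) =
      (hg.comp_measurePreserving hf).toLp (g ∘ f) :=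
  Lp.toLp_compMeasurePreserving hg hf

theorem compMeasurePreserving_cancel {α β : Type*} [MeasurableSpace α] [MeasurableSpace β]
    {μ : Measure α} {ν : Measure β} {f : α → β} {f' : β → α} (hf : MeasurePreserving f μ ν)
    (hf' : MeasurePreserving f' ν μ) (h : Function.LeftInverse f' f) (g : Lp 𝕜 2 μ) :
    Lp.compMeasurePreserving f hf (Lp.compMeasurePreserving f' hf' g) = g := by
  conv_lhs => rw [← Lp.toLp_coeFn g (Lp.memLp g)]
  rw [compMeasurePreserving_toLp, compMeasurePreserving_toLp]
  conv_rhs => rw [← Lp.toLp_coeFn g (Lp.memLp g)]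
  exact MemLp.toLp_congr _ _ (Filter.Eventually.of_forall fun x => congrArg g (h x))

/-- The unitary map `f ↦ f ∘ mapUinv` of `L²(B)` onto `L²(K)`. -/
noncomputable def unitaryU (r : ℝ) : L2 𝕜 (ball r) ≃ₗᵢ[𝕜] L2 𝕜 (octahedron r) where
  toLinearEquiv :=
    { Lp.compMeasurePreservingₗ 𝕜 mapUinv (measurePreserving_mapUinv_restrict r) with
      invFun := Lp.compMeasurePreserving mapU (measurePreserving_mapU_restrict r)
      left_inv := compMeasurePreserving_cancel 𝕜 (measurePreserving_mapU_restrict r)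
        (measurePreserving_mapUinv_restrict r) mapUinv_mapU
      right_inv := compMeasurePreserving_cancel 𝕜 (measurePreserving_mapUinv_restrict r)
        (measurePreserving_mapU_restrict r) mapU_mapUinv }
  norm_map' g := Lp.norm_compMeasurePreserving g (measurePreserving_mapUinv_restrict r)

theorem unitaryU_toLp (r : ℝ) {f : E3 → 𝕜} (hf : MemLp f 2 (volume.restrict (ball r))) :
    unitaryU 𝕜 r (hf.toLp f) =
      (hf.comp_measurePreserving (measurePreserving_mapUinv_restrict r)).toLp (f ∘ mapUinv) :=
  compMeasurePreserving_toLp 𝕜 (measurePreserving_mapUinv_restrict r) hf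

theorem unitaryU_symm_toLp (r : ℝ) {f : E3 → 𝕜}
    (hf : MemLp f 2 (volume.restrict (octahedron r))) :
    (unitaryU 𝕜 r).symm (hf.toLp f) =
      (hf.comp_measurePreserving (measurePreserving_mapU_restrict r)).toLp (f ∘ mapU) :=
  compMeasurePreserving_toLp 𝕜 (measurePreserving_mapU_restrict r) hf

theorem unitaryU_symm_scalingK (r : ℝ) (j : ℕ) (k : Idx j) :
    (unitaryU 𝕜 r).symm (scalingK 𝕜 r j k) = scalingB 𝕜 r j k :=
  unitaryU_symm_toLp 𝕜 r _

theorem map_spaceK (r : ℝ) (j : ℕ) :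
    (spaceK 𝕜 r j).map (unitaryU 𝕜 r).symm.toLinearEquiv.toLinearMap = spaceB 𝕜 r j := by
  rw [spaceK, spaceB, Submodule.map_span, ← Set.range_comp]
  refine congrArg (fun v => Submodule.span 𝕜 (Set.range v)) ?_
  exact funext (unitaryU_symm_scalingK 𝕜 r j)

theorem map_waveletSpace_spaceK (r : ℝ) (j : ℕ) :
    (waveletSpace (spaceK 𝕜 r) j).map (unitaryU 𝕜 r).symm.toLinearEquiv.toLinearMap =
      waveletSpace (spaceB 𝕜 r) j := by
  rw [map_waveletSpace, funext (map_spaceK 𝕜 r)]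

theorem orthonormal_scalingB {r : ℝ} (hr : 0 < r) (j : ℕ) : Orthonormal 𝕜 (scalingB 𝕜 r j) := by
  have h := (orthonormal_scalingK (𝕜 := 𝕜) hr j).comp_linearIsometryEquiv (unitaryU 𝕜 r).symm
  rwa [show (unitaryU 𝕜 r).symm ∘ scalingK 𝕜 r j = scalingB 𝕜 r j from
    funext (unitaryU_symm_scalingK 𝕜 r j)] at h

theorem scalingB_refine {r : ℝ} (hr : 0 < r) (j : ℕ) (k : Idx j) :
    scalingB 𝕜 r j k =
      ∑ m : Fin 8, ((1 / (2 * Real.sqrt 2) : ℝ) : 𝕜) • scalingB 𝕜 r (j + 1) (k, m) := by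
  rw [← unitaryU_symm_scalingK, scalingK_refine hr, map_sum]
  refine Finset.sum_congr rfl fun m _ => ?_
  rw [map_smul]
  exact congrArg _ (unitaryU_symm_scalingK 𝕜 r (j + 1) (k, m))

theorem isMultiresolutionAnalysis_spaceB {r : ℝ} (hr : 0 < r) :
    IsMultiresolutionAnalysis (spaceB 𝕜 r) (scalingB 𝕜 r) where
  nested j := by
    rw [← map_spaceK, ← map_spaceK]
    exact Submodule.map_mono (spaceK_mono hr j)
  dense := by
    have h : (⋃ j, (spaceB 𝕜 r j : Set (L2 𝕜 (ball r)))) =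
        (unitaryU 𝕜 r).symm.toHomeomorph '' ⋃ j, (spaceK 𝕜 r j : Set (L2 𝕜 (octahedron r))) := by
      rw [Set.image_iUnion]
      exact Set.iUnion_congr fun j => by rw [← map_spaceK]; rfl
    rw [h, ← Homeomorph.image_closure, dense_spaceK hr]
    exact Set.image_univ_of_surjective (Homeomorph.surjective _)
  basis j := ⟨orthonormal_scalingB 𝕜 hr j, rfl⟩

theorem waveletB_eq_blockRows (r : ℝ) (a : ∀ j, Idx j → Matrix (Fin 8) (Fin 8) ℝ) (j : ℕ)
    (k : Idx j) (l : Fin 7) : waveletB 𝕜 r a j k l =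
      blockRows (𝕜 := 𝕜) (a j) (scalingB 𝕜 r (j + 1)) (k, l.succ) :=
  toLp_sum_mul Finset.univ (fun m => (a j k l.succ m : 𝕜)) (fun m => scaling 𝕜 r (j + 1) (k, m) ∘ mapU)
    (fun m => memLp_scaling_comp 𝕜 _ r (j + 1) (k, m))
    (memLp_wavelet_comp 𝕜 (volume.restrict (ball r)) r a j k l)

theorem isOrthonormalBasisOf_waveletB {r : ℝ} (hr : 0 < r)
    {a : ∀ j, Idx j → Matrix (Fin 8) (Fin 8) ℝ}
    (ha : ∀ j k, a j k ∈ Matrix.orthogonalGroup (Fin 8) ℝ)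
    (ha0 : ∀ j k m, a j k 0 m = 1 / (2 * Real.sqrt 2)) (j : ℕ) :
    IsOrthonormalBasisOf (fun i : Idx j × Fin 7 => waveletB 𝕜 r a j i.1 i.2)
      (waveletSpace (spaceB 𝕜 r) j) := by
  have h := isOrthonormalBasisOf_blockRows (𝕜 := 𝕜) (ha j) (orthonormal_scalingB 𝕜 hr (j + 1))
  -- The constant row 0 reproduces the refinement equation, so these rows span the coarser space.
  have h0 : (fun k => blockRows (𝕜 := 𝕜) (a j) (scalingB 𝕜 r (j + 1)) (k, 0)) =
      scalingB 𝕜 r j := funext fun k => by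
    rw [scalingB_refine 𝕜 hr]
    exact Finset.sum_congr rfl fun m _ => by rw [ha0]
  rw [h0] at h
  rw [funext fun i : Idx j × Fin 7 => waveletB_eq_blockRows 𝕜 r a j i.1 i.2]
  exact h

end

end BallWavelets

theorem mainTheorem5 {𝕜 : Type*} [RCLike 𝕜] (r : ℝ) (hr : 0 < r) :
    (Set.BijOn mapU (ball r) (octahedron r) ∧ Set.InvOn mapUinv mapU (ball r) (octahedron r)) ∧
    (∃ S : L2 𝕜 (ball r) ≃ₗᵢ[𝕜] L2 𝕜 (octahedron r),
      (∀ (f : E3 → 𝕜) (hf : MemLp f 2 (volume.restrict (ball r))),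
        ∃ hg : MemLp (f ∘ mapUinv) 2 (volume.restrict (octahedron r)),
          S (hf.toLp f) = hg.toLp (f ∘ mapUinv)) ∧
      (∀ (f : E3 → 𝕜) (hf : MemLp f 2 (volume.restrict (octahedron r))),
        ∃ hg : MemLp (f ∘ mapU) 2 (volume.restrict (ball r)),
          S.symm (hf.toLp f) = hg.toLp (f ∘ mapU)) ∧
      (∀ f g : L2 𝕜 (ball r), inner 𝕜 (S f) (S g) = inner 𝕜 f g) ∧
      (∀ f g : L2 𝕜 (octahedron r), inner 𝕜 (S.symm f) (S.symm g) = inner 𝕜 f g) ∧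
      (∀ j, (spaceK 𝕜 r j).map S.symm.toLinearEquiv.toLinearMap = spaceB 𝕜 r j) ∧
      (∀ j, (waveletSpace (spaceK 𝕜 r) j).map S.symm.toLinearEquiv.toLinearMap =
        waveletSpace (spaceB 𝕜 r) j)) ∧
    IsMultiresolutionAnalysis (spaceB 𝕜 r) (scalingB 𝕜 r) ∧
    (∀ a : (j : ℕ) → Idx j → Matrix (Fin 8) (Fin 8) ℝ,
      (∀ j k, a j k ∈ Matrix.orthogonalGroup (Fin 8) ℝ) →
      (∀ j k m, a j k 0 m = 1 / (2 * Real.sqrt 2)) →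
      ∀ j, IsOrthonormalBasisOf
        (fun i : Idx j × Fin 7 => waveletB 𝕜 r a j i.1 i.2)
        (waveletSpace (spaceB 𝕜 r) j)) := by
  refine ⟨⟨bijOn_mapU r, fun p _ => mapUinv_mapU p, fun p _ => mapU_mapUinv p⟩,
    ⟨unitaryU 𝕜 r, fun f hf => ⟨_, unitaryU_toLp 𝕜 r hf⟩,
      fun f hf => ⟨_, unitaryU_symm_toLp 𝕜 r hf⟩, (unitaryU 𝕜 r).inner_map_map,
      (unitaryU 𝕜 r).symm.inner_map_map, map_spaceK 𝕜 r, map_waveletSpace_spaceK 𝕜 r⟩,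
    isMultiresolutionAnalysis_spaceB 𝕜 hr,
    fun a ha ha0 j => isOrthonormalBasisOf_waveletB 𝕜 hr ha ha0 j⟩
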